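/- Let $n,\ell\ge 1$ and $r\ge 0$ be integers, and for $m\ge 0$ let $\Theta_{m}$ be the set of $n\times n$ matrices with nonnegative integer entries whose sum is $m$. For a finite field $k$ and $V=k^m$, let $S_k(n,m)$ be the convolution algebra of $\mathbb Z$-valued $GL(V)$-invariant functions on pairs of $n$-step partial flags $0=F_0\subseteq F_1\subseteq\dots\subseteq F_n=V$, with product $(f f')(F,F'')=\sum_{F'}f(F,F')f'(F',F'')$. For $A=(a_{ij})\in\Theta_m$ let $\mathbf 1_A\in S_k(n,m)$ be the indicator function of the orbit of pairs $(F,F')$ with $\dim\big((F_i\cap F'_j)/((F_{i-1}\cap F'_j)+(F_i\cap F'_{j-1}))\big)=a_{ij}$ for all $i,j$. Let $S_q(n,m)$ be the generic $q$-Schur algebra, i.e. the $\mathbb Z[q]$-subalgebra generated by the elements $1_A=(\mathbf 1_A)_k$, $A\in\Theta_m$, in the product of the algebras $S_k(n,m)$ over all finite fields $k$ (up to isomorphism), where $q$ acts on the factor $S_k(n,m)$ as $|k|$. Let $\mathcal A=\mathbb Z[v,v^{-1}]$ and $S_v(n,m)=\mathcal A\otimes_{\mathbb Z[q]}S_q(n,m)$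 via $q\mapsto v^2$. For a ring homomorphism $\phi\colon\mathcal A\to R$ to a commutative ring put $S_R(n,m)=R\otimes_{\mathcal A}S_v(n,m)$, with $R$ an $\mathcal A$-algebra via $\phi$, and let $S^*_R(n,m)$ be the same tensor product with $R$ an $\mathcal A$-algebra via $v\mapsto\phi(v)^\ell$. In both write $1_A$ for the image of $1_A$. Let $\mathcal A_\ell=\mathcal A/(\Phi_{2\ell}(v))$, where $\Phi_{2\ell}$ is the $2\ell$-th cyclotomic polynomial, and take for $\phi\colon\mathcal A\to\mathcal A_\ell$ the quotient map. Then for every $m\ge 0$ the elements $1_A$, $A\in\Theta_m$, form a $\mathbb Z[q]$-basis of $S_q(n,m)$, and there is a surjective homomorphism of (unital) $\mathcal A_\ell$-algebras $$Q_r\colon S_{\mathcal A_\ell}(n,\ell r)\to S^*_{\mathcal A_\ell}(n,r)$$ such that, for $A\in\Theta_{\ell r}$, $Q_r(1_A)=1_{A/\ell}$ if every entry of $A$ is divisible by $\ell$, and $Q_r(1_A)=0$ otherwise. -/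

import Mathlib

open scoped TensorProduct Polynomial LaurentPolynomial

noncomputable section

namespace QSchurFrobenius

/-! ### Partial flags and the convolution algebra over a finite field -/

/-- `n`-step partial flags `0 = F 0 ≤ F 1 ≤ ⋯ ≤ F n = V` in a vector space `V`. -/
def PartialFlag (k V : Type) [Field k] [AddCommGroup V] [Module k V] (n : ℕ) : Type :=
  {F : Fin (n + 1) → Submodule k V // Monotone F ∧ F 0 = ⊥ ∧ F (Fin.last n) = ⊤}

section Flags

variable {k V : Type} [Field k] [AddCommGroup V] [Module k V] {n : ℕ}

instance instFinitePartialFlag [Finite V] : Finite (PartialFlag k V n) := by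
  have : Finite (Submodule k V) := Finite.of_injective _ SetLike.coe_injective
  exact Subtype.finite

instance instFintypePartialFlag [Finite V] : Fintype (PartialFlag k V n) := Fintype.ofFinite _

instance instDecidableEqPartialFlag : DecidableEq (PartialFlag k V n) := Classical.decEq _

/-- The action of `GL(V)` on partial flags. -/
def PartialFlag.map (g : V ≃ₗ[k] V) (F : PartialFlag k V n) : PartialFlag k V n :=
  ⟨fun i => (F.1 i).map (g : V →ₗ[k] V),
    fun _ _ h => Submodule.map_mono (F.2.1 h),
    by simp [F.2.2.1],
    by simp [F.2.2.2]⟩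

theorem PartialFlag.map_symm_map (g : V ≃ₗ[k] V) (F : PartialFlag k V n) :
    (F.map g).map g.symm = F := by
  apply Subtype.ext
  funext i
  ext x
  simp [PartialFlag.map]

/-- `GL(V)` acts on partial flags by permutations. -/
def PartialFlag.mapEquiv (g : V ≃ₗ[k] V) : PartialFlag k V n ≃ PartialFlag k V n where
  toFun := PartialFlag.map g
  invFun := PartialFlag.map g.symm
  left_inv := PartialFlag.map_symm_map g
  right_inv := PartialFlag.map_symm_map g.symm

/-- The matrix labelling the `GL(V)`-orbit of a pair of flags: its `(i, j)` entry is
`dim ((F_i ∩ F'_j) / ((F_{i-1} ∩ F'_j) + (F_i ∩ F'_{j-1})))`. -/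
def relPos (F F' : PartialFlag k V n) : Matrix (Fin n) (Fin n) ℕ := fun i j =>
  Module.finrank k
    (↥(F.1 i.succ ⊓ F'.1 j.succ) ⧸
      ((F.1 i.castSucc ⊓ F'.1 j.succ) ⊔ (F.1 i.succ ⊓ F'.1 j.castSucc)).submoduleOf
        (F.1 i.succ ⊓ F'.1 j.succ))

theorem finrank_quotient_map (g : V ≃ₗ[k] V) (P Q : Submodule k V) :
    Module.finrank k (↥(P.map (g : V →ₗ[k] V)) ⧸
        (Q.map (g : V →ₗ[k] V)).submoduleOf (P.map (g : V →ₗ[k] V))) =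
      Module.finrank k (↥P ⧸ Q.submoduleOf P) := by
  refine (LinearEquiv.finrank_eq (Submodule.Quotient.equiv _ _ (g.submoduleMap P) ?_)).symm
  ext ⟨x, hx⟩
  obtain ⟨y, hy, rfl⟩ := hx
  simp only [Submodule.submoduleOf, Submodule.mem_map, Submodule.mem_comap,
    Submodule.subtype_apply]
  constructor
  · rintro ⟨z, hz, h⟩
    exact ⟨z, hz, congrArg Subtype.val h⟩
  · rintro ⟨z, hz, h⟩
    have hzy : z = y := g.injective h
    exact ⟨⟨y, hy⟩, hzy ▸ hz, Subtype.ext rfl⟩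

theorem relPos_map (g : V ≃ₗ[k] V) (F F' : PartialFlag k V n) :
    relPos (F.map g) (F'.map g) = relPos F F' := by
  funext i j
  have hinf : ∀ P Q : Submodule k V, P.map (g : V →ₗ[k] V) ⊓ Q.map (g : V →ₗ[k] V) =
      (P ⊓ Q).map (g : V →ₗ[k] V) := fun P Q =>
    (Submodule.map_inf (g : V →ₗ[k] V) g.injective).symm
  have key : ∀ P Q P' Q' : Submodule k V,
      P' = P.map (g : V →ₗ[k] V) → Q' = Q.map (g : V →ₗ[k] V) →
      Module.finrank k (↥P' ⧸ Q'.submoduleOf P') = Module.finrank k (↥P ⧸ Q.submoduleOf P) := by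
    rintro P Q _ _ rfl rfl
    exact finrank_quotient_map g P Q
  refine key _ _ _ _ (hinf _ _) ?_
  rw [Submodule.map_sup, ← hinf, ← hinf]
  rfl

end Flags

/-- `Θ n r` is the set of `n × n` matrices with entries in `ℕ` whose entries sum to `r`. -/
def Θ (n r : ℕ) : Type := {A : Matrix (Fin n) (Fin n) ℕ // ∑ i, ∑ j, A i j = r}

/-- The matrix `ℓ A`, for a matrix `A` in `Θ n r`. -/
def Θ.scale {n r : ℕ} (ℓ : ℕ) (A : Θ n r) : Θ n (ℓ * r) :=
  ⟨fun i j => ℓ * A.1 i j, by simp only [← Finset.mul_sum, A.2]⟩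

/-- The algebra `S_k(n, r)` of `ℤ`-valued `GL(V)`-invariant functions on pairs of `n`-step flags
in `V = k ^ r`. The product of `Matrix` is convolution,
`(f * f') F F'' = ∑ F', f F F' * f' F' F''`. -/
def schurFinite (k : Type) [Field k] [Finite k] (n r : ℕ) :
    Subalgebra ℤ (Matrix (PartialFlag k (Fin r → k) n) (PartialFlag k (Fin r → k) n) ℤ) where
  carrier := {f | ∀ (g : (Fin r → k) ≃ₗ[k] (Fin r → k)) (F F' : PartialFlag k (Fin r → k) n),
    f (F.map g) (F'.map g) = f F F'}
  mul_mem' := by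
    intro f f' hf hf' g F F'
    simp only [Matrix.mul_apply]
    rw [← Equiv.sum_comp (PartialFlag.mapEquiv g)]
    exact Finset.sum_congr rfl fun G _ => by
      change f (F.map g) (G.map g) * f' (G.map g) (F'.map g) = _
      rw [hf, hf']
  add_mem' := by
    intro f f' hf hf' g F F'
    simp only [Matrix.add_apply, hf g F F', hf' g F F']
  algebraMap_mem' := by
    intro c g F F'
    have h : F.map g = F'.map g ↔ F = F' := (PartialFlag.mapEquiv g).injective.eq_iff
    simp only [Matrix.algebraMap_matrix_apply, h]

open Classical in
/-- The indicator function of the orbit labelled by `A`. -/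
def indicator (k : Type) [Field k] [Finite k] {n r : ℕ} (A : Θ n r) : schurFinite k n r :=
  ⟨fun F F' => if relPos F F' = A.1 then 1 else 0, fun g F F' => by simp only [relPos_map]⟩

/-! ### The generic `q`-Schur algebra -/

/-- The isomorphism classes of finite fields: pairs `(p, m)` with `p` prime and `m ≥ 1`. -/
abbrev FieldIndex : Type := Nat.Primes × ℕ+

instance instFactPrime (x : FieldIndex) : Fact (x.1 : ℕ).Prime := ⟨x.1.2⟩

/-- The finite field with `p ^ m` elements. -/
abbrev FF (x : FieldIndex) : Type := GaloisField (x.1 : ℕ) (x.2 : ℕ)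

instance instFiniteFF (x : FieldIndex) : Finite (FF x) := Module.finite_of_finite (ZMod (x.1 : ℕ))

/-- The product of the algebras `S_k(n, r)` over all finite fields `k`. -/
def SchurFamily (n r : ℕ) : Type := (x : FieldIndex) → schurFinite (FF x) n r

instance instRingSchurFamily (n r : ℕ) : Ring (SchurFamily n r) :=
  inferInstanceAs (Ring ((x : FieldIndex) → schurFinite (FF x) n r))

/-- `ℤ[q]` acts on the component at `k` by evaluation at `q = |k|`. -/
instance instAlgebraSchurFamily (n r : ℕ) : Algebra ℤ[X] (SchurFamily n r) :=
  RingHom.toAlgebra'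
    (RingHom.pi fun x : FieldIndex =>
      (algebraMap ℤ (schurFinite (FF x) n r)).comp (Polynomial.evalRingHom (Nat.card (FF x) : ℤ)))
    (fun p f => funext fun x =>
      Algebra.commutes (Polynomial.eval (Nat.card (FF x) : ℤ) p) (f x))

/-- The family of all indicator functions of orbits labelled by `A`, one for each finite field. -/
def indicatorFamily {n r : ℕ} (A : Θ n r) : SchurFamily n r := fun x => indicator (FF x) A

/-- The generic `q`-Schur algebra `S_q(n, r)` over `ℤ[q]`, realised as the `ℤ[q]`-subalgebra
generated by the elements `1_A` inside the product of the `S_k(n, r)` over all finite fields `k`.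
A polynomial is determined by its values at prime powers, so this is the `ℤ[q]`-algebra
with basis the `1_A` which specialises to `S_k(n, r)` at `q = |k|`, with `1_A` specialising to the
indicator function. -/
def QSchur (n r : ℕ) : Subalgebra ℤ[X] (SchurFamily n r) :=
  Algebra.adjoin ℤ[X] (Set.range (indicatorFamily (n := n) (r := r)))

/-- The element `1_A` of `S_q(n, r)`. -/
def QSchur.one {n r : ℕ} (A : Θ n r) : QSchur n r :=
  ⟨indicatorFamily A, Algebra.subset_adjoin ⟨A, rfl⟩⟩

/-! ### Extension of scalars -/

/-- Extension of scalars `S ⊗[R] B` along a ring homomorphism `φ : R →+* S`. -/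
def BaseChange {R S : Type} [CommRing R] [CommRing S] (φ : R →+* S)
    (B : Type) [Ring B] [Algebra R B] : Type :=
  @TensorProduct R _ S B _ _ φ.toAlgebra.toModule _

section BaseChange

variable {R S : Type} [CommRing R] [CommRing S] (φ : R →+* S) (B : Type) [Ring B] [Algebra R B]

instance instRingBaseChange : Ring (BaseChange φ B) :=
  @Algebra.TensorProduct.instRing R S B _ _ φ.toAlgebra _ _

instance instAlgebraBaseChange : Algebra S (BaseChange φ B) :=
  letI := φ.toAlgebra
  (Algebra.TensorProduct.leftAlgebra : Algebra S (S ⊗[R] B))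

variable {B}

/-- The element `1 ⊗ b` of the extension of scalars. -/
def BaseChange.of (b : B) : BaseChange φ B :=
  @TensorProduct.tmul R _ S B _ _ φ.toAlgebra.toModule _ 1 b

end BaseChange

/-- The ring homomorphism `ℤ[q] → ℤ[v, v⁻¹]`, `q ↦ v ^ 2`. -/
def qToV : ℤ[X] →+* ℤ[T;T⁻¹] :=
  Polynomial.eval₂RingHom (Int.castRingHom ℤ[T;T⁻¹]) (LaurentPolynomial.T 2)

/-- The algebra `S_v(n, r)` over `ℤ[v, v⁻¹]`. -/
abbrev SchurV (n r : ℕ) : Type := BaseChange qToV (QSchur n r)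

/-- The specialisation `S_R(n, r)` along `φ : ℤ[v, v⁻¹] →+* R`. -/
abbrev SchurSpec {R : Type} [CommRing R] (φ : ℤ[T;T⁻¹] →+* R) (n r : ℕ) : Type :=
  BaseChange φ (SchurV n r)

/-- The basis element `1_A` of `S_R(n, r)`. -/
def SchurSpec.one {R : Type} [CommRing R] (φ : ℤ[T;T⁻¹] →+* R) {n r : ℕ} (A : Θ n r) :
    SchurSpec φ n r :=
  BaseChange.of φ (BaseChange.of qToV (QSchur.one A))

/-- The indeterminate `v` as a unit of `ℤ[v, v⁻¹]`. -/
def vUnit : (ℤ[T;T⁻¹])ˣ where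
  val := LaurentPolynomial.T 1
  inv := LaurentPolynomial.T (-1)
  val_inv := by rw [← LaurentPolynomial.T_add]; simp
  inv_val := by rw [← LaurentPolynomial.T_add]; simp

/-- The homomorphism `ℤ[v, v⁻¹] →+* R` with `v ↦ φ(v) ^ ℓ`. -/
def powSpec {R : Type} [CommRing R] (φ : ℤ[T;T⁻¹] →+* R) (ℓ : ℕ) : ℤ[T;T⁻¹] →+* R :=
  LaurentPolynomial.eval₂ (Int.castRingHom R) (Units.map (φ : ℤ[T;T⁻¹] →* R) vUnit ^ ℓ)

/-- The ring `𝒜_ℓ = ℤ[v, v⁻¹] / (Φ_{2ℓ}(v))`. -/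
abbrev CycloRing (ℓ : ℕ) : Type :=
  ℤ[T;T⁻¹] ⧸ Ideal.span {Polynomial.toLaurent (Polynomial.cyclotomic (2 * ℓ) ℤ)}

/-- The quotient map `ℤ[v, v⁻¹] →+* 𝒜_ℓ`. -/
abbrev cycloMap (ℓ : ℕ) : ℤ[T;T⁻¹] →+* CycloRing ℓ := Ideal.Quotient.mk _

end QSchurFrobenius

end

noncomputable section

namespace QSchurFrobenius

/-! ### Cumulative sums of matrices and relative position -/

/-! The product `1_A 1_B` has as its coefficient at `1_C` the number of flags `E` with `relPos F E =
A` and `relPos E F' = B`, where `relPos F F' = C`. Two facts about this number carry the theorem.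

It is an integer polynomial in `|k|` (`exists_structurePoly`). A flag `E` is a chain of subspaces
with prescribed intersection dimensions, so it suffices to count the subspaces `U ≤ W` of given type
(`exists_hall_poly`). Counting pairs of such a `U` and a nonzero linear form on `W` killing it
reduces to hyperplanes of `W`, up to a factor `q ^ e - 1`. The division by it can be done in `ℤ[X]`
because it can be done at every prime (`dvd_of_forall_prime_eval_dvd`). Hence the `1_A` span the
algebra; they are independent because every matrix occurs as a relative position over every field.

Modulo `Φ_ℓ(q)` it is compatible with scaling by `ℓ`. Let `K/k` have degree `ℓ` and let `F`, `F'` be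
`K`-flags, viewed over `k`. Then `Kˣ` acts on the `k`-flags `E` in given positions to them. The
fixed points are the `K`-flags, counted by a structure polynomial at `q ^ ℓ`, and there are none
unless `ℓ` divides both matrices. Any other orbit has `(q ^ ℓ - 1) / (q ^ d - 1)` elements for a
proper divisor `d` of `ℓ`, a multiple of `Φ_ℓ(q)`. Taking `k` prime gives divisibilities in `ℤ[X]`
(`cyclotomic_dvd_structurePoly_sub_expand`, `cyclotomic_dvd_structurePoly`). Since `Φ_{2ℓ}(v)`
divides `Φ_ℓ(v ^ 2)`, these say that the linear map prescribed on the basis is multiplicative. -/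

/-- The sum of the entries of `A` strictly above row `i` and strictly left of column `j`. -/
def cumSum {n : ℕ} (A : Matrix (Fin n) (Fin n) ℕ) (i j : Fin (n + 1)) : ℕ :=
  ∑ a, ∑ b, if a.castSucc < i ∧ b.castSucc < j then A a b else 0

section cumSum

variable {n : ℕ}

theorem cumSum_zero_left (A : Matrix (Fin n) (Fin n) ℕ) (j : Fin (n + 1)) : cumSum A 0 j = 0 := by
  simp [cumSum]

theorem cumSum_zero_right (A : Matrix (Fin n) (Fin n) ℕ) (i : Fin (n + 1)) : cumSum A i 0 = 0 := by
  simp [cumSum]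

theorem cumSum_last_last (A : Matrix (Fin n) (Fin n) ℕ) :
    cumSum A (Fin.last n) (Fin.last n) = ∑ i, ∑ j, A i j := by
  simp [cumSum, Fin.castSucc_lt_last]

/-- The matrix `ℓ A`. -/
def scaleMatrix (ℓ : ℕ) (A : Matrix (Fin n) (Fin n) ℕ) : Matrix (Fin n) (Fin n) ℕ :=
  fun i j => ℓ * A i j

theorem cumSum_scaleMatrix (ℓ : ℕ) (A : Matrix (Fin n) (Fin n) ℕ) (i j : Fin (n + 1)) :
    cumSum (scaleMatrix ℓ A) i j = ℓ * cumSum A i j := by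
  simp [cumSum, scaleMatrix, Finset.mul_sum]

theorem cumSum_succ_succ (A : Matrix (Fin n) (Fin n) ℕ) (i j : Fin n) :
    A i j + cumSum A i.castSucc j.succ + cumSum A i.succ j.castSucc =
      cumSum A i.succ j.succ + cumSum A i.castSucc j.castSucc := by
  have h : A i j = ∑ a, ∑ b, if a = i ∧ b = j then A a b else 0 := by
    simp [ite_and, Finset.sum_ite_eq']
  rw [h]
  simp only [cumSum, ← Finset.sum_add_distrib]
  refine Finset.sum_congr rfl fun a _ => Finset.sum_congr rfl fun b _ => ?_
  simp only [Fin.lt_def, Fin.ext_iff, Fin.val_castSucc, Fin.val_succ]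
  split_ifs <;> omega

/-- A function on the grid vanishing on two edges is determined by its mixed second differences. The
relation is written additively to avoid subtraction in `ℕ`. -/
theorem eq_cumSum {A : Matrix (Fin n) (Fin n) ℕ} {d : Fin (n + 1) → Fin (n + 1) → ℕ}
    (h0 : ∀ j, d 0 j = 0) (h0' : ∀ i, d i 0 = 0)
    (h : ∀ i j : Fin n, A i j + d i.castSucc j.succ + d i.succ j.castSucc =
      d i.succ j.succ + d i.castSucc j.castSucc) (i j : Fin (n + 1)) :
    d i j = cumSum A i j := by
  induction i using Fin.induction generalizing j with
  | zero => rw [h0, cumSum_zero_left]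
  | succ i hi =>
    induction j using Fin.induction with
    | zero => rw [h0', cumSum_zero_right]
    | succ j hj =>
      have h1 := h i j
      have h2 := cumSum_succ_succ A i j
      rw [hi, hi, hj] at h1
      omega

theorem cumSum_injective : Function.Injective (cumSum (n := n)) := by
  intro A B h
  ext i j
  have h1 := cumSum_succ_succ A i j
  have h2 := cumSum_succ_succ B i j
  rw [h] at h1
  omega

end cumSum

section relPos

variable {k V : Type} [Field k] [AddCommGroup V] [Module k V] [FiniteDimensional k V] {n : ℕ}

/-- The two subspaces divided out meet in `F_{i-1} ∩ F'_{j-1}`, so this is the dimension formula for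
their sum. -/
theorem relPos_add (F F' : PartialFlag k V n) (i j : Fin n) :
    relPos F F' i j + Module.finrank k ↥(F.1 i.castSucc ⊓ F'.1 j.succ) +
        Module.finrank k ↥(F.1 i.succ ⊓ F'.1 j.castSucc) =
      Module.finrank k ↥(F.1 i.succ ⊓ F'.1 j.succ) +
        Module.finrank k ↥(F.1 i.castSucc ⊓ F'.1 j.castSucc) := by
  have hi : F.1 i.castSucc ≤ F.1 i.succ := F.2.1 i.castSucc_le_succ
  have hj : F'.1 j.castSucc ≤ F'.1 j.succ := F'.2.1 j.castSucc_le_succ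
  have h1 := Submodule.finrank_sup_add_finrank_inf_eq
    (F.1 i.castSucc ⊓ F'.1 j.succ) (F.1 i.succ ⊓ F'.1 j.castSucc)
  have h2 : (F.1 i.castSucc ⊓ F'.1 j.succ) ⊓ (F.1 i.succ ⊓ F'.1 j.castSucc) =
      F.1 i.castSucc ⊓ F'.1 j.castSucc := by
    rw [inf_inf_inf_comm, inf_eq_left.2 hi, inf_eq_right.2 hj]
  have h3 : (F.1 i.castSucc ⊓ F'.1 j.succ) ⊔ (F.1 i.succ ⊓ F'.1 j.castSucc) ≤
      F.1 i.succ ⊓ F'.1 j.succ :=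
    sup_le (inf_le_inf_right _ hi) (inf_le_inf_left _ hj)
  have h4 := Submodule.finrank_quotient_add_finrank
    (((F.1 i.castSucc ⊓ F'.1 j.succ) ⊔ (F.1 i.succ ⊓ F'.1 j.castSucc)).submoduleOf
        (F.1 i.succ ⊓ F'.1 j.succ))
  rw [(Submodule.submoduleOfEquivOfLe h3).finrank_eq] at h4
  rw [h2] at h1
  change relPos F F' i j + _ = _ at h4
  omega

theorem finrank_inf_eq_cumSum (F F' : PartialFlag k V n) (i j : Fin (n + 1)) :
    Module.finrank k ↥(F.1 i ⊓ F'.1 j) = cumSum (relPos F F') i j :=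
  eq_cumSum (d := fun i j => Module.finrank k ↥(F.1 i ⊓ F'.1 j))
    (fun j => by simp [F.2.2.1]) (fun i => by simp [F'.2.2.1]) (relPos_add F F') i j

/-- Turns relative position into separate conditions on intersection dimensions, which behave well
under chains and restriction of scalars. -/
theorem relPos_eq_iff {F F' : PartialFlag k V n} {A : Matrix (Fin n) (Fin n) ℕ} :
    relPos F F' = A ↔ ∀ i j, Module.finrank k ↥(F.1 i ⊓ F'.1 j) = cumSum A i j := by
  refine ⟨fun h i j => h ▸ finrank_inf_eq_cumSum F F' i j, fun h => cumSum_injective ?_⟩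
  funext i j
  rw [← h, finrank_inf_eq_cumSum]

theorem sum_relPos (F F' : PartialFlag k V n) :
    ∑ i, ∑ j, relPos F F' i j = Module.finrank k V := by
  rw [← cumSum_last_last, ← finrank_inf_eq_cumSum, F.2.2.2, F'.2.2.2, inf_top_eq, finrank_top]

/-- Needed to expand the unit of the algebra in the `1_A`. -/
theorem relPos_isDiag_iff {F F' : PartialFlag k V n} : (relPos F F').IsDiag ↔ F = F' := by
  constructor
  · intro h
    -- For a diagonal matrix this says `dim (F_i ∩ F'_i) = dim F_i = dim F'_i`.
    have key : ∀ i, cumSum (relPos F F') i i = cumSum (relPos F F') i (Fin.last n) ∧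
        cumSum (relPos F F') i i = cumSum (relPos F F') (Fin.last n) i := by
      intro i
      constructor <;>
      · refine Finset.sum_congr rfl fun a _ => Finset.sum_congr rfl fun b _ => ?_
        by_cases hab : a = b
        · subst hab
          simp [Fin.castSucc_lt_last]
        · rw [h hab]
          simp
    apply Subtype.ext
    funext i
    obtain ⟨h1, h2⟩ := key i
    rw [← finrank_inf_eq_cumSum, ← finrank_inf_eq_cumSum, F'.2.2.2, inf_top_eq] at h1
    rw [← finrank_inf_eq_cumSum, ← finrank_inf_eq_cumSum, F.2.2.2, top_inf_eq] at h2
    exact (Submodule.eq_of_le_of_finrank_eq inf_le_left h1).symm.trans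
      (Submodule.eq_of_le_of_finrank_eq inf_le_right h2)
  · rintro rfl i j hij
    have h := relPos_add F F i j
    rcases lt_or_gt_of_ne hij with hij | hij
    · have h1 : F.1 i.succ ⊓ F.1 j.castSucc = F.1 i.succ ⊓ F.1 j.succ := by
        rw [inf_eq_left.2 (F.2.1 (Fin.succ_le_castSucc_iff.2 hij)),
          inf_eq_left.2 (F.2.1 (Fin.succ_le_succ_iff.2 hij.le))]
      have h2 : F.1 i.castSucc ⊓ F.1 j.castSucc = F.1 i.castSucc ⊓ F.1 j.succ := by
        rw [inf_eq_left.2 (F.2.1 (Fin.castSucc_le_castSucc_iff.2 hij.le)), inf_eq_left.2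
          (F.2.1 ((Fin.castSucc_le_castSucc_iff.2 hij.le).trans j.castSucc_le_succ))]
      rw [h1, h2] at h
      omega
    · have h1 : F.1 i.castSucc ⊓ F.1 j.succ = F.1 i.succ ⊓ F.1 j.succ := by
        rw [inf_eq_right.2 (F.2.1 (Fin.succ_le_castSucc_iff.2 hij)),
          inf_eq_right.2 (F.2.1 (Fin.succ_le_succ_iff.2 hij.le))]
      have h2 : F.1 i.castSucc ⊓ F.1 j.castSucc = F.1 i.succ ⊓ F.1 j.castSucc := by
        rw [inf_eq_right.2 (F.2.1 (Fin.castSucc_le_castSucc_iff.2 hij.le)), inf_eq_right.2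
          (F.2.1 ((Fin.castSucc_le_castSucc_iff.2 hij.le).trans i.castSucc_le_succ))]
      rw [h1, h2] at h
      omega

end relPos

/-! ### Coordinate flags -/

section coordinates

variable {k V : Type} [Field k] [AddCommGroup V] [Module k V] {n : ℕ}

/-- The span of the basis vectors `b x` with `x ∈ s`. -/
def coordSubspace {ι : Type} (b : Module.Basis ι k V) (s : Set ι) : Submodule k V :=
  (Finsupp.supported k k s).comap (b.repr : V →ₗ[k] ι →₀ k)

/-- The flag of coordinate subspaces attached to a basis whose elements are labelled by steps. -/
def coordFlag {ι : Type} (b : Module.Basis ι k V) (f : ι → Fin n) : PartialFlag k V n :=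
  ⟨fun i => coordSubspace b {x | (f x).castSucc < i},
    fun _ _ h => Submodule.comap_mono (Finsupp.supported_mono fun _ hx => lt_of_lt_of_le hx h),
    by
      simp only [coordSubspace, Fin.not_lt_zero, Set.ofPred_false, Finsupp.supported_empty]
      exact LinearMap.ker_eq_bot.2 b.repr.injective,
    by simp [coordSubspace, Fin.castSucc_lt_last, Finsupp.supported_univ]⟩

theorem finrank_coordSubspace {ι : Type} (b : Module.Basis ι k V) (s : Set ι) [Fintype s] :
    Module.finrank k (coordSubspace b s) = Fintype.card s := by
  rw [coordSubspace,
    (b.repr.submoduleMap _ |>.trans (LinearEquiv.ofEq _ _ (Submodule.map_comap_eq_of_surjective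
      b.repr.surjective (Finsupp.supported k k s)))).finrank_eq,
    (Finsupp.supportedEquivFinsupp s).finrank_eq, Module.finrank_finsupp_self]

/-- Take a basis with `A i j` vectors in cell `(i, j)`; one coordinate flag filters by rows, the
other by columns. -/
theorem exists_relPos_eq [FiniteDimensional k V] (A : Matrix (Fin n) (Fin n) ℕ)
    (h : Module.finrank k V = ∑ i, ∑ j, A i j) : ∃ F F' : PartialFlag k V n, relPos F F' = A := by
  let b : Module.Basis (Σ x : Fin n × Fin n, Fin (A x.1 x.2)) k V :=
    (Module.finBasis k V).reindex (Fintype.equivOfCardEq (by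
      simp [h, Fintype.sum_prod_type]))
  refine ⟨coordFlag b fun x => x.1.1, coordFlag b fun x => x.1.2, relPos_eq_iff.2 fun i j => ?_⟩
  have h1 : (coordFlag b fun x => x.1.1).1 i ⊓ (coordFlag b fun x => x.1.2).1 j =
      coordSubspace b {x | x.1.1.castSucc < i ∧ x.1.2.castSucc < j} := by
    simp only [coordFlag, coordSubspace, ← Submodule.comap_inf, ← Finsupp.supported_inter]
    rfl
  rw [h1, finrank_coordSubspace, Fintype.card_subtype, Finset.card_filter, Fintype.sum_sigma,
    Fintype.sum_prod_type]
  simp [cumSum, apply_ite Finset.card]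

end coordinates

/-! ### Integer polynomials and their values at primes -/

theorem infinite_prime_cast : {x : ℤ | ∃ p : ℕ, p.Prime ∧ (p : ℤ) = x}.Infinite :=
  Nat.infinite_setOfPred_prime.image Nat.cast_injective.injOn

theorem eq_of_forall_prime_eval_eq {P Q : ℤ[X]}
    (h : ∀ p : ℕ, p.Prime → P.eval (p : ℤ) = Q.eval (p : ℤ)) : P = Q := by
  refine Polynomial.eq_of_infinite_eval_eq P Q (infinite_prime_cast.mono ?_)
  rintro _ ⟨p, hp, rfl⟩
  exact h p hp

/-- The remainder `R` modulo `M` also satisfies `M(p) ∣ R(p)`, but has smaller degree, so `|R(p)| <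
|M(p)|` for large `p`. Thus `R` has infinitely many roots. -/
theorem dvd_of_forall_prime_eval_dvd {M P : ℤ[X]} (hM : M.Monic)
    (h : ∀ p : ℕ, p.Prime → M.eval (p : ℤ) ∣ P.eval (p : ℤ)) : M ∣ P := by
  rw [← Polynomial.modByMonic_eq_zero_iff_dvd hM]
  set R := P %ₘ M with hR
  have hdvd : ∀ p : ℕ, p.Prime → M.eval (p : ℤ) ∣ R.eval (p : ℤ) := by
    intro p hp
    rw [hR, Polynomial.modByMonic_eq_sub_mul_div, Polynomial.eval_sub, Polynomial.eval_mul]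
    exact dvd_sub (h p hp) (dvd_mul_right _ _)
  have hinj := RingHom.injective_int (Int.castRingHom ℝ)
  have hlim := Polynomial.div_tendsto_atTop_zero_of_degree_lt (R.map (Int.castRingHom ℝ))
    (M.map (Int.castRingHom ℝ)) (by
      rw [Polynomial.degree_map_eq_of_injective hinj, Polynomial.degree_map_eq_of_injective hinj]
      exact Polynomial.degree_modByMonic_lt P hM)
  have hev := (hlim.comp tendsto_natCast_atTop_atTop).eventually
    (Metric.ball_mem_nhds (0 : ℝ) one_pos)
  obtain ⟨N, hN⟩ := Filter.eventually_atTop.1 hev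
  refine Polynomial.eq_zero_of_infinite_isRoot R ?_
  have hinf : ({p : ℕ | p.Prime} \ Set.Iio N).Infinite :=
    Nat.infinite_setOfPred_prime.sdiff (Set.finite_Iio N)
  refine (hinf.image (Nat.cast_injective (R := ℤ)).injOn).mono ?_
  rintro _ ⟨p, ⟨hp, hpN⟩, rfl⟩
  have h1 := hN p (not_lt.1 hpN)
  simp only [Function.comp_apply, dist_zero_right, Polynomial.eval_natCast_map,
    eq_intCast, Real.norm_eq_abs, abs_div] at h1
  -- Real division by zero gives zero, so `h1` is vacuous when `M(p) = 0`; divisibility by zero then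
  -- gives `R(p) = 0` directly.
  by_cases h0 : M.eval (p : ℤ) = 0
  · have := hdvd p hp
    rw [h0, zero_dvd_iff] at this
    exact this
  · rw [div_lt_one (by positivity)] at h1
    exact Int.eq_zero_of_abs_lt_dvd ((abs_dvd _ _).2 (hdvd p hp)) (by exact_mod_cast h1)

/-! ### The type of a subspace with respect to a pair of flags -/

/-- The dimensions of the intersections of `U` with the subspaces `F_i ∩ F'_j`. -/
def flagType {k V : Type} [Field k] [AddCommGroup V] [Module k V] {n : ℕ}
    (F F' : PartialFlag k V n) (U : Submodule k V) (x : Fin (n + 1) × Fin (n + 1)) : ℕ :=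
  Module.finrank k ↥(U ⊓ (F.1 x.1 ⊓ F'.1 x.2))

/-- The dimension of a sum of subspaces `P_i ∩ Q_j` is determined by the dimensions of the
subspaces `P_i ∩ Q_j`. -/
theorem exists_finrank_sup_eq {n : ℕ} (T : Finset (Fin (n + 1) × Fin (n + 1))) :
    ∃ s : (Fin (n + 1) × Fin (n + 1) → ℕ) → ℕ, ∀ (k V : Type) [Field k] [AddCommGroup V]
      [Module k V] [FiniteDimensional k V] (P Q : Fin (n + 1) → Submodule k V),
      Monotone P → Monotone Q →
      Module.finrank k ↥(T.sup fun x => P x.1 ⊓ Q x.2) =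
        s fun x => Module.finrank k ↥(P x.1 ⊓ Q x.2) := by
  -- Labels are added in decreasing order of the first coordinate, so the new one always has the
  -- smallest `P`-index.
  induction T using Finset.induction_on_min_value
    (fun x : Fin (n + 1) × Fin (n + 1) => x.1) with
  | empty => exact ⟨fun _ => 0, fun k V _ _ _ _ P Q _ _ => by simp⟩
  | insert a T _ hmin ih =>
    obtain ⟨s, hs⟩ := ih
    -- If some old label dominates `a` in both coordinates, the new term is redundant.
    by_cases hT : ∃ x ∈ T, a.2 ≤ x.2
    · obtain ⟨x, hx, hax⟩ := hT
      refine ⟨s, fun k V _ _ _ _ P Q hP hQ => ?_⟩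
      rw [Finset.sup_insert, sup_eq_right.2, hs k V P Q hP hQ]
      exact (inf_le_inf (hP (hmin x hx)) (hQ hax)).trans
        (Finset.le_sup (f := fun x => P x.1 ⊓ Q x.2) hx)
    · rcases T.eq_empty_or_nonempty with rfl | hne
      · exact ⟨fun c => c a, fun k V _ _ _ _ P Q hP hQ => by
          rw [insert_empty_eq, Finset.sup_singleton]⟩
      · obtain ⟨x, hx, hmax⟩ := T.exists_max_image (fun x => x.2) hne
        push Not at hT
        refine ⟨fun c => s c + c a - c (a.1, x.2), fun k V _ _ _ _ P Q hP hQ => ?_⟩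
        have h1 := Submodule.finrank_sup_add_finrank_inf_eq (P a.1 ⊓ Q a.2)
          (T.sup fun x => P x.1 ⊓ Q x.2)
        -- Otherwise the new term meets the old sum in one subspace of the family, where `x.2` is
        -- the largest second index in `T`.
        have h2 : (P a.1 ⊓ Q a.2) ⊓ (T.sup fun x => P x.1 ⊓ Q x.2) = P a.1 ⊓ Q x.2 := by
          apply le_antisymm
          · refine le_inf (inf_le_left.trans inf_le_left) (inf_le_right.trans ?_)
            exact Finset.sup_le fun y hy => inf_le_right.trans (hQ (hmax y hy))
          · refine le_inf (inf_le_inf_left _ (hQ (hT x hx).le)) ?_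
            exact (inf_le_inf_right _ (hP (hmin x hx))).trans
              (Finset.le_sup (f := fun x => P x.1 ⊓ Q x.2) hx)
        rw [h2, hs k V P Q hP hQ] at h1
        rw [Finset.sup_insert]
        dsimp only
        omega

theorem card_dual_le_ker {k W : Type} [Field k] [AddCommGroup W] [Module k W]
    [FiniteDimensional k W] (Y : Submodule k W) :
    Nat.card {φ : Module.Dual k W // Y ≤ LinearMap.ker φ} =
      Nat.card k ^ (Module.finrank k W - Module.finrank k Y) := by
  have h : ∀ φ : Module.Dual k W, Y ≤ LinearMap.ker φ ↔ φ ∈ Y.dualAnnihilator := fun φ => by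
    rw [Submodule.mem_dualAnnihilator]; rfl
  rw [Nat.card_congr (Equiv.subtypeEquivRight h)]
  change Nat.card ↥Y.dualAnnihilator = _
  rw [Module.natCard_eq_pow_finrank (K := k)]
  have := Subspace.finrank_add_finrank_dualAnnihilator_eq Y
  congr 1
  omega

section flagType

variable {k V : Type} [Field k] [AddCommGroup V] [Module k V] {n : ℕ} (F F' : PartialFlag k V n)

theorem finrank_comap_subtype (W X : Submodule k V) :
    Module.finrank k ↥(X.comap W.subtype) = Module.finrank k ↥(W ⊓ X) := by
  rw [← Submodule.map_comap_subtype, Submodule.finrank_map_subtype_eq]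

theorem flagType_last (U : Submodule k V) :
    flagType F F' U (Fin.last n, Fin.last n) = Module.finrank k U := by
  rw [flagType, F.2.2.2, F'.2.2.2, inf_top_eq, inf_top_eq]

theorem flagType_mono [FiniteDimensional k V] {U W : Submodule k V} (h : U ≤ W) :
    flagType F F' U ≤ flagType F F' W :=
  fun _ => Submodule.finrank_mono (inf_le_inf_right _ h)

/-- The flag induced on a subspace. -/
def PartialFlag.comap (W : Submodule k V) (F : PartialFlag k V n) : PartialFlag k W n :=
  ⟨fun i => (F.1 i).comap W.subtype, fun _ _ h => Submodule.comap_mono (F.2.1 h),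
    by simp [F.2.2.1], by simp [F.2.2.2]⟩

theorem flagType_eq_cumSum [FiniteDimensional k V] (W : Submodule k V)
    (x : Fin (n + 1) × Fin (n + 1)) :
    flagType F F' W x = cumSum (relPos (F.comap W) (F'.comap W)) x.1 x.2 := by
  rw [← finrank_inf_eq_cumSum, flagType, ← finrank_comap_subtype]
  rfl

open Classical in
/-- The labels `(i, j)` such that the linear form `φ` vanishes on `W ∩ F_i ∩ F'_j`. -/
def vanishingSet (W : Submodule k V) (φ : Module.Dual k W) :
    Finset (Fin (n + 1) × Fin (n + 1)) :=
  {x | (F.1 x.1 ⊓ F'.1 x.2).comap W.subtype ≤ LinearMap.ker φ}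

theorem mem_vanishingSet {W : Submodule k V} {φ : Module.Dual k W}
    {x : Fin (n + 1) × Fin (n + 1)} : x ∈ vanishingSet F F' W φ ↔
      (F.1 x.1 ⊓ F'.1 x.2).comap W.subtype ≤ LinearMap.ker φ := by
  classical
  rw [vanishingSet, Finset.mem_filter]
  simp only [Finset.mem_univ, true_and]

theorem last_mem_vanishingSet (W : Submodule k V) (φ : Module.Dual k W) :
    (Fin.last n, Fin.last n) ∈ vanishingSet F F' W φ ↔ φ = 0 := by
  rw [mem_vanishingSet, F.2.2.2, F'.2.2.2, inf_top_eq, Submodule.comap_top, top_le_iff,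
    LinearMap.ker_eq_top]

/-- The kernel of a linear form on a subspace, as a subspace of the ambient space. -/
def kerIn (W : Submodule k V) (φ : Module.Dual k W) : Submodule k V :=
  (LinearMap.ker φ).map W.subtype

/-- A linear form lowers the dimension of a subspace by one exactly when it does not vanish there.
So the type of the kernel depends only on the type of `W` and the vanishing set. -/
theorem flagType_kerIn [FiniteDimensional k V] (W : Submodule k V) (φ : Module.Dual k W) :
    flagType F F' (kerIn W φ) = fun x => if x ∈ vanishingSet F F' W φ then flagType F F' W x else
      flagType F F' W x - 1 := by
  funext x
  set Y := (F.1 x.1 ⊓ F'.1 x.2).comap W.subtype with hY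
  have h1 : flagType F F' W x = Module.finrank k Y := (finrank_comap_subtype _ _).symm
  have h2 : flagType F F' (kerIn W φ) x = Module.finrank k ↥(Y ⊓ LinearMap.ker φ) := by
    rw [flagType, ← Submodule.finrank_map_subtype_eq W (Y ⊓ LinearMap.ker φ), kerIn]
    suffices h : (LinearMap.ker φ).map W.subtype ⊓ (F.1 x.1 ⊓ F'.1 x.2) =
      (Y ⊓ LinearMap.ker φ).map W.subtype by rw [h]
    ext v
    simp only [hY, Submodule.mem_inf, Submodule.mem_map, Submodule.mem_comap,
      Submodule.subtype_apply]
    constructor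
    · rintro ⟨⟨w, hw, rfl⟩, h⟩
      exact ⟨w, ⟨h, hw⟩, rfl⟩
    · rintro ⟨w, ⟨h, hw⟩, rfl⟩
      exact ⟨⟨w, hw, rfl⟩, h⟩
  have h3 : x ∈ vanishingSet F F' W φ ↔ Y ≤ LinearMap.ker φ := mem_vanishingSet F F'
  split_ifs with hx
  · rw [h2, h1, inf_eq_left.2 (h3.1 hx)]
  · have hne : φ.domRestrict Y ≠ 0 := fun h0 => hx (h3.2 fun y hy =>
      LinearMap.congr_fun h0 ⟨y, hy⟩)
    have h4 := Module.Dual.finrank_ker_add_one_of_ne_zero hne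
    have h5 : LinearMap.ker (φ.domRestrict Y) = (LinearMap.ker φ).comap Y.subtype := rfl
    rw [h5, finrank_comap_subtype] at h4
    omega

end flagType

/-! ### Counting linear forms -/

/-- These forms are the annihilator of the sum of the subspaces labelled by `S`, whose dimension
`exists_finrank_sup_eq` reads off from the type. -/
theorem exists_poly_card_subset_vanishingSet {n : ℕ} (c : Fin (n + 1) × Fin (n + 1) → ℕ)
    (S : Finset (Fin (n + 1) × Fin (n + 1))) :
    ∃ p : ℤ[X], ∀ (k V : Type) [Field k] [Finite k] [AddCommGroup V] [Module k V] [Finite V]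
      (F F' : PartialFlag k V n) (W : Submodule k V), flagType F F' W = c →
      (Nat.card {φ : Module.Dual k W // S ⊆ vanishingSet F F' W φ} : ℤ) =
        p.eval (Nat.card k : ℤ) := by
  obtain ⟨s, hs⟩ := exists_finrank_sup_eq S
  refine ⟨Polynomial.X ^ (c (Fin.last n, Fin.last n) - s c), ?_⟩
  intro k V _ _ _ _ _ F F' W hW
  have h1 := hs k W (F.comap W).1 (F'.comap W).1 (F.comap W).2.1 (F'.comap W).2.1
  have h2 : (fun x : Fin (n + 1) × Fin (n + 1) => Module.finrank k
      ↥((F.comap W).1 x.1 ⊓ (F'.comap W).1 x.2)) = c := by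
    rw [← hW]
    funext x
    exact finrank_comap_subtype W (F.1 x.1 ⊓ F'.1 x.2)
  have h3 : ∀ φ : Module.Dual k W, S ⊆ vanishingSet F F' W φ ↔
      (S.sup fun x => (F.comap W).1 x.1 ⊓ (F'.comap W).1 x.2) ≤ LinearMap.ker φ := by
    intro φ
    rw [Finset.sup_le_iff]
    simp only [Finset.subset_iff, mem_vanishingSet]
    rfl
  rw [Nat.card_congr (Equiv.subtypeEquivRight h3), card_dual_le_ker, h1, h2, ← flagType_last F F',
    hW]
  simp

/-- Inclusion–exclusion: from the forms vanishing at least on `S`, remove those with a strictly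
larger vanishing set, by induction downwards from the full set. -/
theorem exists_poly_card_vanishingSet_eq {n : ℕ} (c : Fin (n + 1) × Fin (n + 1) → ℕ)
    (S : Finset (Fin (n + 1) × Fin (n + 1))) :
    ∃ p : ℤ[X], ∀ (k V : Type) [Field k] [Finite k] [AddCommGroup V] [Module k V] [Finite V]
      (F F' : PartialFlag k V n) (W : Submodule k V), flagType F F' W = c →
      (Nat.card {φ : Module.Dual k W // vanishingSet F F' W φ = S} : ℤ) =
        p.eval (Nat.card k : ℤ) := by
  classical
  induction S using WellFoundedGT.induction with
  | ind S ih =>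
    choose! e he using ih
    obtain ⟨p, hp⟩ := exists_poly_card_subset_vanishingSet c S
    refine ⟨p - ∑ T with S ⊂ T, e T, ?_⟩
    intro k V _ _ _ _ _ F F' W hW
    have : Finite (Module.Dual k W) := Module.finite_of_finite k
    have : Fintype (Module.Dual k W) := Fintype.ofFinite _
    have h1 := hp k V F F' W hW
    rw [Nat.card_eq_fintype_card, Fintype.card_subtype,
      Finset.card_eq_sum_card_fiberwise (f := vanishingSet F F' W)
        (t := insert S ({T | S ⊂ T} : Finset (Finset (Fin (n + 1) × Fin (n + 1)))))
        (by
          intro φ hφ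
          simp only [Finset.coe_filter, Finset.mem_univ, true_and, Set.mem_ofPred_eq] at hφ
          simpa [eq_comm] using hφ.eq_or_ssubset),
      Finset.sum_insert (by simp)] at h1
    have h2 : ∀ T, S ⊆ T → (Finset.card {φ ∈ {φ : Module.Dual k W | S ⊆ vanishingSet F F' W φ} |
        vanishingSet F F' W φ = T} : ℕ) =
        Nat.card {φ : Module.Dual k W // vanishingSet F F' W φ = T} := by
      intro T hT
      rw [Nat.card_eq_fintype_card, Fintype.card_subtype, Finset.filter_filter]
      congr 1
      ext φ
      simp only [Finset.mem_filter, Finset.mem_univ, true_and, and_iff_right_iff_imp]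
      rintro rfl
      exact hT
    rw [h2 S subset_rfl] at h1
    rw [Polynomial.eval_sub, Polynomial.eval_finsetSum, ← h1]
    push_cast
    rw [eq_sub_iff_add_eq]
    congr 1
    refine Finset.sum_congr rfl fun T hT => ?_
    have hT' : S ⊂ T := by simpa using hT
    rw [h2 T hT'.subset, he T hT' k V F F' W hW]

/-! ### Hall polynomials -/

section counting

variable {k V : Type} [Field k] [AddCommGroup V] [Module k V] {n : ℕ} (F F' : PartialFlag k V n)

/-- The subspaces of `W` of a given type. -/
abbrev SubspaceOfType (W : Submodule k V) (d : Fin (n + 1) × Fin (n + 1) → ℕ) : Type :=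
  {U : Submodule k V // U ≤ W ∧ flagType F F' U = d}

theorem flagType_last_right (U : Submodule k V) (i : Fin (n + 1)) :
    flagType F F' U (i, Fin.last n) = Module.finrank k ↥(F.1 i ⊓ U) := by
  rw [flagType, F'.2.2.2, inf_top_eq, inf_comm]

theorem flagType_last_left (U : Submodule k V) (i : Fin (n + 1)) :
    flagType F F' U (Fin.last n, i) = Module.finrank k ↥(U ⊓ F'.1 i) := by
  rw [flagType, F.2.2.2, top_inf_eq]

variable [Finite k] [Finite V]

theorem card_dual_ne_zero_le_kerIn {W U : Submodule k V} (h : U ≤ W) :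
    (Nat.card {φ : Module.Dual k W // φ ≠ 0 ∧ U ≤ kerIn W φ} : ℤ) =
      (Nat.card k : ℤ) ^ (Module.finrank k W - Module.finrank k U) - 1 := by
  classical
  have : Finite (Module.Dual k W) := Module.finite_of_finite k
  have : Fintype (Module.Dual k W) := Fintype.ofFinite _
  have h1 : ∀ φ : Module.Dual k W, U ≤ kerIn W φ ↔ U.comap W.subtype ≤ LinearMap.ker φ := by
    intro φ
    rw [kerIn]
    constructor
    · intro h' w hw
      obtain ⟨w', hw', h''⟩ := h' hw
      rwa [← W.injective_subtype h'']
    · exact fun h' u hu => ⟨⟨u, h hu⟩, h' hu, rfl⟩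
  have h2 := card_dual_le_ker (U.comap W.subtype)
  rw [finrank_comap_subtype, inf_eq_right.2 h] at h2
  rw [← Nat.cast_pow, ← h2, Nat.card_eq_fintype_card, Nat.card_eq_fintype_card,
    Fintype.card_subtype, Fintype.card_subtype, eq_sub_iff_add_eq]
  simp only [h1]
  rw [← Finset.card_erase_add_one (a := 0) (s := Finset.univ.filter fun φ : Module.Dual k W =>
    U.comap W.subtype ≤ LinearMap.ker φ) (by simp)]
  push_cast
  congr 3
  ext φ
  simp

/-- Double counting of pairs `(U, φ)` with `φ ≠ 0` and `U` inside the kernel of `φ`. -/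
theorem card_subspaceOfType_mul (W : Submodule k V) (d : Fin (n + 1) × Fin (n + 1) → ℕ)
    [Fintype (Module.Dual k W)] [DecidableEq (Module.Dual k W)] :
    (Nat.card (SubspaceOfType F F' W d) : ℤ) *
        ((Nat.card k : ℤ) ^ (Module.finrank k W - d (Fin.last n, Fin.last n)) - 1) =
      ∑ φ : Module.Dual k W, if φ = 0 then 0 else
        (Nat.card (SubspaceOfType F F' (kerIn W φ) d) : ℤ) := by
  classical
  have : Finite (Submodule k V) := Finite.of_injective _ SetLike.coe_injective
  have : Fintype (Submodule k V) := Fintype.ofFinite _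
  have h := Finset.sum_card_bipartiteAbove_eq_sum_card_bipartiteBelow
    (s := Finset.univ.filter fun U : Submodule k V => U ≤ W ∧ flagType F F' U = d)
    (t := Finset.univ.filter fun φ : Module.Dual k W => φ ≠ 0) (fun U φ => U ≤ kerIn W φ)
  have hl : ∀ U ∈ Finset.univ.filter fun U : Submodule k V => U ≤ W ∧ flagType F F' U = d,
      ((Finset.bipartiteAbove (fun U φ => U ≤ kerIn W φ)
        (Finset.univ.filter fun φ : Module.Dual k W => φ ≠ 0) U).card : ℤ) =
        (Nat.card k : ℤ) ^ (Module.finrank k W - d (Fin.last n, Fin.last n)) - 1 := by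
    intro U hU
    obtain ⟨hUW, hUd⟩ := (Finset.mem_filter.1 hU).2
    rw [← hUd, flagType_last, ← card_dual_ne_zero_le_kerIn hUW, Nat.card_eq_fintype_card,
      Fintype.card_subtype, Finset.bipartiteAbove, Finset.filter_filter]
  have hr : ∀ φ : Module.Dual k W, Finset.card (Finset.bipartiteBelow (fun U φ => U ≤ kerIn W φ)
      (Finset.univ.filter fun U : Submodule k V => U ≤ W ∧ flagType F F' U = d) φ) =
      Nat.card (SubspaceOfType F F' (kerIn W φ) d) := by
    intro φ
    rw [Nat.card_eq_fintype_card, Fintype.card_subtype, Finset.bipartiteBelow,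
      Finset.filter_filter]
    congr 1
    ext U
    simp only [Finset.mem_filter, Finset.mem_univ, true_and]
    exact ⟨fun h => ⟨h.2, h.1.2⟩, fun h =>
      ⟨⟨h.1.trans (Submodule.map_subtype_le W _), h.2⟩, h.1⟩⟩
  have h' := congrArg (Nat.cast (R := ℤ)) h
  push_cast at h'
  rw [Finset.sum_congr rfl hl, Finset.sum_const, nsmul_eq_mul] at h'
  rw [Nat.card_eq_fintype_card, Fintype.card_subtype, h', Finset.sum_filter]
  refine Finset.sum_congr rfl fun φ _ => ?_
  rw [hr, ite_not]

end counting

/-- A type that occurs over one finite field occurs over all finite fields. -/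
theorem exists_flagType_eq {n : ℕ} {k V : Type} [Field k] [AddCommGroup V] [Module k V]
    [FiniteDimensional k V] (F F' : PartialFlag k V n) (W : Submodule k V)
    (K : Type) [Field K] : ∃ E E' : PartialFlag K (Fin (Module.finrank k W) → K) n,
      flagType E E' ⊤ = flagType F F' W := by
  obtain ⟨E, E', h⟩ := exists_relPos_eq (k := K) (V := Fin (Module.finrank k W) → K)
    (relPos (F.comap W) (F'.comap W)) (by rw [sum_relPos]; simp)
  refine ⟨E, E', funext fun x => ?_⟩
  rw [flagType_eq_cumSum F F', ← h, ← finrank_inf_eq_cumSum, flagType, top_inf_eq]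

/-- Induction on `dim W = c (last, last)`: the nonzero forms are sorted by vanishing set, which
fixes the type of the kernel. -/
theorem exists_hall_poly {n : ℕ} (c d : Fin (n + 1) × Fin (n + 1) → ℕ) :
    ∃ p : ℤ[X], ∀ (k V : Type) [Field k] [Finite k] [AddCommGroup V] [Module k V] [Finite V]
      (F F' : PartialFlag k V n) (W : Submodule k V), flagType F F' W = c →
      (Nat.card (SubspaceOfType F F' W d) : ℤ) = p.eval (Nat.card k : ℤ) := by
  classical
  induction hN : c (Fin.last n, Fin.last n) using Nat.strong_induction_on generalizing c with
  | _ N ih =>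
  subst hN
  rcases le_or_gt (c (Fin.last n, Fin.last n)) (d (Fin.last n, Fin.last n)) with hcd | hcd
  -- With `dim U ≥ dim W`, only `U = W` is possible.
  · refine ⟨if c = d then 1 else 0, fun k V _ _ _ _ _ F F' W hW => ?_⟩
    have h1 : ∀ U, U ≤ W → flagType F F' U = d → U = W := fun U hU hUd =>
      Submodule.eq_of_le_of_finrank_le hU (by
        rw [← flagType_last F F', ← flagType_last F F', hW, hUd]; exact hcd)
    split_ifs with h
    · have : Unique (SubspaceOfType F F' W d) :=
        ⟨⟨⟨W, le_rfl, hW.trans h⟩⟩, fun U => Subtype.ext (h1 U.1 U.2.1 U.2.2)⟩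
      simp
    · have : IsEmpty (SubspaceOfType F F' W d) :=
        ⟨fun U => h (by rw [← hW, ← h1 U.1 U.2.1 U.2.2, U.2.2])⟩
      simp
  have ih' : ∀ S : Finset (Fin (n + 1) × Fin (n + 1)), (Fin.last n, Fin.last n) ∉ S →
      ∃ p : ℤ[X], ∀ (k V : Type) [Field k] [Finite k] [AddCommGroup V] [Module k V] [Finite V]
        (F F' : PartialFlag k V n) (W : Submodule k V),
        flagType F F' W = (fun x => if x ∈ S then c x else c x - 1) →
        (Nat.card (SubspaceOfType F F' W d) : ℤ) = p.eval (Nat.card k : ℤ) := fun S hS =>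
    ih _ (by rw [if_neg hS]; omega) _ rfl
  choose! f hf using ih'
  choose e he using exists_poly_card_vanishingSet_eq c
  -- Excluding the sets that contain the label of `V` excludes precisely `φ = 0`.
  set P : ℤ[X] := ∑ S with (Fin.last n, Fin.last n) ∉ S, e S * f S with hP
  set M : ℤ[X] := Polynomial.X ^ (c (Fin.last n, Fin.last n) - d (Fin.last n, Fin.last n)) - 1
    with hM
  have hMm : M.Monic := Polynomial.monic_X_pow_sub_C (1 : ℤ) (by omega)
  have key : ∀ (k V : Type) [Field k] [Finite k] [AddCommGroup V] [Module k V] [Finite V]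
      (F F' : PartialFlag k V n) (W : Submodule k V), flagType F F' W = c →
      (Nat.card (SubspaceOfType F F' W d) : ℤ) * M.eval (Nat.card k : ℤ) =
        P.eval (Nat.card k : ℤ) := by
    intro k V _ _ _ _ _ F F' W hW
    have : Finite (Module.Dual k W) := Module.finite_of_finite k
    have : Fintype (Module.Dual k W) := Fintype.ofFinite _
    have h1 := card_subspaceOfType_mul F F' W d
    rw [← flagType_last F F', hW] at h1
    simp only [hM, Polynomial.eval_sub, Polynomial.eval_pow, Polynomial.eval_X,
      Polynomial.eval_one]
    rw [h1, hP, Polynomial.eval_finsetSum, ← Finset.sum_fiberwise Finset.univ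
      (vanishingSet F F' W), Finset.sum_filter]
    refine Finset.sum_congr rfl fun S _ => ?_
    by_cases hS : (Fin.last n, Fin.last n) ∉ S
    · rw [if_pos hS, Polynomial.eval_mul, ← he S k V F F' W hW, Nat.card_eq_fintype_card,
        Fintype.card_subtype, ← nsmul_eq_mul, ← Finset.sum_const]
      refine Finset.sum_congr rfl fun φ hφ => ?_
      have hφ' : vanishingSet F F' W φ = S := (Finset.mem_filter.1 hφ).2
      rw [if_neg (fun h0 => hS (hφ' ▸ (last_mem_vanishingSet F F' W φ).2 h0))]
      refine hf S hS k V F F' (kerIn W φ) ?_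
      rw [flagType_kerIn, hφ', hW]
    · rw [if_neg hS]
      refine Finset.sum_eq_zero fun φ hφ => ?_
      have hφ' : vanishingSet F F' W φ = S := (Finset.mem_filter.1 hφ).2
      rw [if_pos ((last_mem_vanishingSet F F' W φ).1 (by rw [hφ']; exact not_not.1 hS))]
  by_cases hc : ∀ p : ℕ, p.Prime → M.eval (p : ℤ) ∣ P.eval (p : ℤ)
  · obtain ⟨h, hh⟩ := dvd_of_forall_prime_eval_dvd hMm hc
    refine ⟨h, fun k V _ _ _ _ _ F F' W hW => ?_⟩
    have h1 := key k V F F' W hW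
    rw [hh, Polynomial.eval_mul, mul_comm] at h1
    refine mul_left_cancel₀ ?_ h1
    have h2 : (1 : ℤ) < (Nat.card k : ℤ) := by exact_mod_cast Finite.one_lt_card
    simp only [hM, Polynomial.eval_sub, Polynomial.eval_pow, Polynomial.eval_X,
      Polynomial.eval_one]
    exact sub_ne_zero.2 (one_lt_pow₀ h2 (by omega)).ne'
  -- If divisibility fails at some prime, the type `c` occurs over no finite field and any
  -- polynomial will do: an occurrence could be copied to every `ZMod p`, where `key` yields the
  -- divisibility.
  · refine ⟨0, fun k V _ _ _ _ _ F F' W hW => (hc fun p hp => ?_).elim⟩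
    have : Fact p.Prime := ⟨hp⟩
    obtain ⟨E, E', hE⟩ := exists_flagType_eq F F' W (ZMod p)
    have h1 := key (ZMod p) _ E E' ⊤ (hE.trans hW)
    rw [Nat.card_zmod] at h1
    exact ⟨_, by rw [← h1, mul_comm]⟩

theorem exists_poly_sum_subspaces {n : ℕ} (f : (Fin (n + 1) × Fin (n + 1) → ℕ) → ℤ[X])
    (c : Fin (n + 1) × Fin (n + 1) → ℕ) :
    ∃ p : ℤ[X], ∀ (k V : Type) [Field k] [Finite k] [AddCommGroup V] [Module k V] [Finite V]
      (F F' : PartialFlag k V n) (W : Submodule k V) [Fintype {U : Submodule k V // U ≤ W}],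
      flagType F F' W = c →
      ∑ U : {U : Submodule k V // U ≤ W}, (f (flagType F F' U.1)).eval (Nat.card k : ℤ) =
        p.eval (Nat.card k : ℤ) := by
  classical
  choose h hh using exists_hall_poly c
  refine ⟨∑ d ∈ Finset.Iic c, h d * f d, fun k V _ _ _ _ _ F F' W _ hW => ?_⟩
  rw [Polynomial.eval_finsetSum, ← Finset.sum_fiberwise_of_maps_to
    (g := fun U : {U : Submodule k V // U ≤ W} => flagType F F' U.1) (t := Finset.Iic c)
    (fun U _ => Finset.mem_Iic.2 (hW ▸ flagType_mono F F' U.2))]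
  refine Finset.sum_congr rfl fun d _ => ?_
  have h1 : Nat.card (SubspaceOfType F F' W d) =
      (Finset.univ.filter fun U : {U : Submodule k V // U ≤ W} => flagType F F' U.1 = d).card := by
    rw [SubspaceOfType, ← Nat.card_congr (Equiv.subtypeSubtypeEquivSubtypeInter
      (fun U : Submodule k V => U ≤ W) (fun U => flagType F F' U = d)), Nat.card_eq_fintype_card,
      Fintype.card_subtype]
  rw [Polynomial.eval_mul, ← hh d k V F F' W hW, h1, ← nsmul_eq_mul, ← Finset.sum_const]
  exact Finset.sum_congr rfl fun U hU => by rw [(Finset.mem_filter.1 hU).2]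

/-! ### Counting chains of subspaces -/

/-- Chains of subspaces ending at `W` whose members have types satisfying given conditions. -/
abbrev ChainOfType {k V : Type} [Field k] [AddCommGroup V] [Module k V] {n s : ℕ}
    (F F' : PartialFlag k V n) (P : Fin (s + 1) → (Fin (n + 1) × Fin (n + 1) → ℕ) → Prop)
    (W : Submodule k V) : Type :=
  {U : Fin (s + 1) → Submodule k V //
    Monotone U ∧ U (Fin.last s) = W ∧ ∀ j, P j (flagType F F' (U j))}

/-- A chain is obtained by adjoining its last member to a shorter chain. -/
def ChainOfType.initEquiv {k V : Type} [Field k] [AddCommGroup V] [Module k V] {n s : ℕ}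
    (F F' : PartialFlag k V n) (P : Fin (s + 2) → (Fin (n + 1) × Fin (n + 1) → ℕ) → Prop)
    (W : Submodule k V) (hW : P (Fin.last _) (flagType F F' W)) :
    ChainOfType F F' P W ≃
      Σ U : {U : Submodule k V // U ≤ W}, ChainOfType F F' (fun j => P j.castSucc) U.1 where
  toFun U := ⟨⟨U.1 (Fin.last s).castSucc, (U.2.1 (Fin.le_last _)).trans_eq U.2.2.1⟩,
    fun j => U.1 j.castSucc, fun _ _ h => U.2.1 (Fin.castSucc_le_castSucc_iff.2 h), rfl,
    fun j => U.2.2.2 j.castSucc⟩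
  invFun U := ⟨Fin.snoc (α := fun _ => Submodule k V) U.2.1 W, by
      refine ⟨?_, Fin.snoc_last .., ?_⟩
      · rw [Fin.monotone_iff_le_succ]
        intro j
        rw [Fin.snoc_castSucc]
        induction j using Fin.lastCases with
        | last =>
          rw [Fin.succ_last, Fin.snoc_last, U.2.2.2.1]
          exact U.1.2
        | cast j =>
          rw [← Fin.castSucc_succ, Fin.snoc_castSucc]
          exact U.2.2.1 j.castSucc_le_succ
      · intro j
        induction j using Fin.lastCases with
        | last => rwa [Fin.snoc_last]
        | cast j => rw [Fin.snoc_castSucc]; exact U.2.2.2.2 j⟩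
  left_inv U := by
    apply Subtype.ext
    funext j
    induction j using Fin.lastCases with
    | last => rw [U.2.2.1]; exact Fin.snoc_last (α := fun _ => Submodule k V) ..
    | cast j => exact Fin.snoc_castSucc (α := fun _ => Submodule k V) ..
  right_inv U := by
    refine Sigma.subtype_ext (Subtype.ext ?_) ?_
    · dsimp only
      rw [Fin.snoc_castSucc, U.2.2.2.1]
    · funext j
      dsimp only
      rw [Fin.snoc_castSucc]

/-- Induction on the length: remove `W` from the chain and sum over its predecessor `U ≤ W`,
weighted by a polynomial depending only on the type of `U`. -/
theorem exists_poly_card_chainOfType {n : ℕ} (s : ℕ)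
    (P : Fin (s + 1) → (Fin (n + 1) × Fin (n + 1) → ℕ) → Prop)
    (c : Fin (n + 1) × Fin (n + 1) → ℕ) :
    ∃ p : ℤ[X], ∀ (k V : Type) [Field k] [Finite k] [AddCommGroup V] [Module k V] [Finite V]
      (F F' : PartialFlag k V n) (W : Submodule k V), flagType F F' W = c →
      (Nat.card (ChainOfType F F' P W) : ℤ) = p.eval (Nat.card k : ℤ) := by
  classical
  by_cases hPc : P (Fin.last s) c
  swap
  · refine ⟨0, fun k V _ _ _ _ _ F F' W hW => ?_⟩
    have : IsEmpty (ChainOfType F F' P W) := ⟨fun U => hPc (by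
      have := U.2.2.2 (Fin.last s)
      rwa [U.2.2.1, hW] at this)⟩
    simp
  induction s generalizing c with
  | zero =>
    refine ⟨1, fun k V _ _ _ _ _ F F' W hW => ?_⟩
    have : Unique (ChainOfType F F' P W) :=
      ⟨⟨⟨fun _ => W, monotone_const, rfl, fun j => by
        rw [Fin.fin_one_eq_zero j, hW]; exact hPc⟩⟩, fun U => Subtype.ext <|
          funext fun j => by rw [Fin.fin_one_eq_zero j]; exact U.2.2.1⟩
    simp
  | succ s ih =>
    have ih' : ∀ c, ∃ p : ℤ[X], ∀ (k V : Type) [Field k] [Finite k] [AddCommGroup V] [Module k V]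
        [Finite V] (F F' : PartialFlag k V n) (W : Submodule k V), flagType F F' W = c →
        (Nat.card (ChainOfType F F' (fun j : Fin (s + 1) => P j.castSucc) W) : ℤ) =
          p.eval (Nat.card k : ℤ) := by
      intro c
      by_cases h : P (Fin.last s).castSucc c
      · exact ih _ c h
      · refine ⟨0, fun k V _ _ _ _ _ F F' W hW => ?_⟩
        have : IsEmpty (ChainOfType F F' (fun j : Fin (s + 1) => P j.castSucc) W) :=
          ⟨fun U => h (by
            have := U.2.2.2 (Fin.last s)
            rwa [U.2.2.1, hW] at this)⟩
        simp
    choose f hf using ih'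
    obtain ⟨p, hp⟩ := exists_poly_sum_subspaces f c
    refine ⟨p, fun k V _ _ _ _ _ F F' W hW => ?_⟩
    have : Finite (Submodule k V) := Finite.of_injective _ SetLike.coe_injective
    have : Fintype {U : Submodule k V // U ≤ W} := Fintype.ofFinite _
    rw [Nat.card_congr (ChainOfType.initEquiv F F' P W (hW ▸ hPc)), Nat.card_sigma,
      ← hp k V F F' W hW]
    push_cast
    exact Finset.sum_congr rfl fun U _ => hf _ k V F F' U.1 rfl

/-! ### Structure polynomials -/

/-- The flags in relative position `A` to `F` and such that `F'` is in relative position `B` to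
them. -/
abbrev Middle {k V : Type} [Field k] [AddCommGroup V] [Module k V] {n : ℕ}
    (A B : Matrix (Fin n) (Fin n) ℕ) (F F' : PartialFlag k V n) : Type :=
  {E : PartialFlag k V n // relPos F E = A ∧ relPos E F' = B}

theorem exists_structurePoly {n : ℕ} (A B C : Matrix (Fin n) (Fin n) ℕ) :
    ∃ p : ℤ[X], ∀ (k V : Type) [Field k] [Finite k] [AddCommGroup V] [Module k V] [Finite V]
      (F F' : PartialFlag k V n), relPos F F' = C →
      (Nat.card (Middle A B F F') : ℤ) = p.eval (Nat.card k : ℤ) := by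
  -- Since the last step of each flag is `V`, these values of the type are the dimensions of `F_i ∩
  -- U` and `U ∩ F'_i`.
  let P : Fin (n + 1) → (Fin (n + 1) × Fin (n + 1) → ℕ) → Prop := fun j c =>
    (∀ i, c (i, Fin.last n) = cumSum A i j) ∧ ∀ i, c (Fin.last n, i) = cumSum B j i
  obtain ⟨p, hp⟩ := exists_poly_card_chainOfType n P (fun x => cumSum C x.1 x.2)
  refine ⟨p, fun k V _ _ _ _ _ F F' hF => ?_⟩
  rw [← hp k V F F' ⊤ (by
    funext x
    rw [flagType, top_inf_eq, relPos_eq_iff.1 hF])]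
  congr 1
  have hP : ∀ (j) (U : Submodule k V), P j (flagType F F' U) ↔
      (∀ i, Module.finrank k ↥(F.1 i ⊓ U) = cumSum A i j) ∧
        ∀ i, Module.finrank k ↥(U ⊓ F'.1 i) = cumSum B j i := by
    intro j U
    simp only [P, flagType_last_left, flagType_last_right]
  refine Nat.card_congr ⟨fun E => ⟨E.1.1, E.1.2.1, E.1.2.2.2, fun j => (hP _ _).2
    ⟨fun i => relPos_eq_iff.1 E.2.1 i j, fun i => relPos_eq_iff.1 E.2.2 j i⟩⟩,
    fun U => ⟨⟨U.1, U.2.1, ?_, U.2.2.1⟩, relPos_eq_iff.2 fun i j => ((hP _ _).1 (U.2.2.2 j)).1 i,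
      relPos_eq_iff.2 fun i j => ((hP _ _).1 (U.2.2.2 i)).2 j⟩, fun _ => rfl, fun _ => rfl⟩
  -- Chains are not required to start at `0`; the prescribed dimension `cumSum B 0 _ = 0` forces it.
  have h := ((hP _ _).1 (U.2.2.2 0)).2 (Fin.last n)
  rwa [F'.2.2.2, inf_top_eq, cumSum_zero_left, Submodule.finrank_eq_zero] at h

/-- The structure constant of the generic `q`-Schur algebra, as a polynomial in `q`. -/
def structurePoly {n : ℕ} (A B C : Matrix (Fin n) (Fin n) ℕ) : ℤ[X] :=
  (exists_structurePoly A B C).choose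

theorem eval_structurePoly {n : ℕ} (A B : Matrix (Fin n) (Fin n) ℕ) {k V : Type} [Field k]
    [Finite k] [AddCommGroup V] [Module k V] [Finite V] (F F' : PartialFlag k V n) :
    (structurePoly A B (relPos F F')).eval (Nat.card k : ℤ) = Nat.card (Middle A B F F') :=
  ((exists_structurePoly A B (relPos F F')).choose_spec k V F F' rfl).symm

/-! ### Flags over a field extension -/

section extension

variable (k : Type) {K V : Type} [Field k] [Field K] [Algebra k K] [AddCommGroup V] [Module K V]
  [Module k V] [IsScalarTower k K V] {n : ℕ}

/-- A flag over an extension field, regarded as a flag over the ground field. -/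
def PartialFlag.restrictScalars (F : PartialFlag K V n) : PartialFlag k V n :=
  ⟨fun i => (F.1 i).restrictScalars k, fun _ _ h => F.2.1 h, by simp [F.2.2.1], by simp [F.2.2.2]⟩

/-- Restriction of scalars multiplies every intersection dimension by `[K : k]`. -/
theorem relPos_restrictScalars_eq_iff [FiniteDimensional k K] [FiniteDimensional K V]
    [FiniteDimensional k V] {F F' : PartialFlag K V n} {A : Matrix (Fin n) (Fin n) ℕ} :
    relPos (F.restrictScalars k) (F'.restrictScalars k) = (scaleMatrix (Module.finrank k K) A) ↔
      relPos F F' = A := by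
  rw [relPos_eq_iff, relPos_eq_iff]
  refine forall₂_congr fun i j => ?_
  have h : Module.finrank k
      ↥((F.restrictScalars k).1 i ⊓ (F'.restrictScalars k).1 j) =
        Module.finrank k K * Module.finrank K ↥(F.1 i ⊓ F'.1 j) :=
    (Module.finrank_mul_finrank k K ↥(F.1 i ⊓ F'.1 j)).symm
  rw [h, cumSum_scaleMatrix]
  exact mul_right_inj' Module.finrank_pos.ne'

theorem relPos_restrictScalars [FiniteDimensional k K] [FiniteDimensional K V]
    [FiniteDimensional k V] (F F' : PartialFlag K V n) :
    relPos (F.restrictScalars k) (F'.restrictScalars k) =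
      scaleMatrix (Module.finrank k K) (relPos F F') :=
  (relPos_restrictScalars_eq_iff k).2 rfl

variable {k}

/-- The subspaces in a flag over the ground field are stable under multiplication by `a`. -/
def PartialFlag.StableUnder (E : PartialFlag k V n) (a : K) : Prop :=
  ∀ j, ∀ v ∈ E.1 j, a • v ∈ E.1 j

/-- A flag over the ground field that is stable under an extension field is a flag over it. -/
def PartialFlag.extendScalars (E : PartialFlag k V n) (h : ∀ a : K, E.StableUnder a) :
    PartialFlag K V n :=
  ⟨fun i => { (E.1 i).toAddSubmonoid with smul_mem' := fun a v hv => h a i v hv },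
    fun _ _ hij => E.2.1 hij,
    by ext v; change v ∈ E.1 0 ↔ _; simp [E.2.2.1],
    by ext v; change v ∈ E.1 (Fin.last n) ↔ _; simp [E.2.2.2]⟩

theorem card_stable_middle [FiniteDimensional k K] [FiniteDimensional K V] [FiniteDimensional k V]
    (A B : Matrix (Fin n) (Fin n) ℕ) (F F' : PartialFlag K V n) :
    Nat.card {E : Middle (scaleMatrix (Module.finrank k K) A)
      (scaleMatrix (Module.finrank k K) B) (F.restrictScalars k) (F'.restrictScalars k) //
        ∀ a : K, E.1.StableUnder a} = Nat.card (Middle A B F F') :=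
  Nat.card_congr ⟨fun E => ⟨E.1.1.extendScalars E.2,
      (relPos_restrictScalars_eq_iff k).1 E.1.2.1, (relPos_restrictScalars_eq_iff k).1 E.1.2.2⟩,
    fun E => ⟨⟨E.1.restrictScalars k, (relPos_restrictScalars_eq_iff k).2 E.2.1,
      (relPos_restrictScalars_eq_iff k).2 E.2.2⟩, fun a j _ hv => (E.1.1 j).smul_mem a hv⟩,
    fun _ => rfl, fun _ => rfl⟩

theorem dvd_of_stable_middle [FiniteDimensional k K] [FiniteDimensional K V]
    [FiniteDimensional k V] {A B : Matrix (Fin n) (Fin n) ℕ} {F F' : PartialFlag K V n}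
    (E : Middle A B (F.restrictScalars k) (F'.restrictScalars k))
    (hE : ∀ a : K, E.1.StableUnder a) :
    (∀ i j, Module.finrank k K ∣ A i j) ∧ ∀ i j, Module.finrank k K ∣ B i j := by
  have h : E.1 = (E.1.extendScalars hE).restrictScalars k := rfl
  obtain ⟨h1, h2⟩ := E.2
  rw [h, relPos_restrictScalars] at h1 h2
  constructor
  · rintro i j
    rw [← h1]
    exact dvd_mul_right _ _
  · rintro i j
    rw [← h2]
    exact dvd_mul_right _ _

/-! ### The action of the multiplicative group of the extension field -/

instance instMulActionPartialFlag : MulAction Kˣ (PartialFlag k V n) where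
  smul u E := E.map (DistribMulAction.toLinearEquiv k V u)
  one_smul E := by
    apply Subtype.ext
    funext j
    ext v
    change v ∈ (E.1 j).map _ ↔ _
    simp
  mul_smul u u' E := by
    apply Subtype.ext
    funext j
    ext v
    change v ∈ (E.1 j).map _ ↔ v ∈ ((E.1 j).map _).map _
    simp [mul_smul]

theorem smul_restrictScalars (u : Kˣ) (F : PartialFlag K V n) :
    u • F.restrictScalars k = F.restrictScalars k := by
  apply Subtype.ext
  funext j
  ext v
  change v ∈ ((F.1 j).restrictScalars k).map _ ↔ _
  constructor
  · rintro ⟨w, hw, rfl⟩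
    exact (F.1 j).smul_mem (u : K) hw
  · intro hv
    exact ⟨u⁻¹ • v, (F.1 j).smul_mem ((u⁻¹ : Kˣ) : K) hv, smul_inv_smul u v⟩

theorem relPos_smul (u : Kˣ) (E E' : PartialFlag k V n) : relPos (u • E) (u • E') = relPos E E' :=
  relPos_map _ E E'

/-- Stability only gives an inclusion of each step's image in the step; equal dimensions make it an
equality. -/
theorem stableUnder_unit_iff [FiniteDimensional k V] (u : Kˣ) (E : PartialFlag k V n) :
    E.StableUnder (u : K) ↔ u • E = E := by
  constructor
  · intro h
    apply Subtype.ext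
    funext j
    refine Submodule.eq_of_le_of_finrank_eq ?_ (LinearEquiv.finrank_map_eq
      (DistribMulAction.toLinearEquiv k V u) (E.1 j))
    rintro _ ⟨v, hv, rfl⟩
    exact h j v hv
  · intro h j v hv
    rw [← h]
    exact ⟨v, hv, rfl⟩

theorem stableUnder_smul (u : Kˣ) (a : K) (E : PartialFlag k V n) (h : E.StableUnder a) :
    (u • E).StableUnder a := by
  rintro j _ ⟨v, hv, rfl⟩
  exact ⟨a • v, h j v hv, smul_comm u a v⟩

/-- The intermediate field of those scalars that stabilise a flag. -/
def stableField [FiniteDimensional k V] (E : PartialFlag k V n) : IntermediateField k K where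
  carrier := {a | E.StableUnder a}
  mul_mem' ha hb j v hv := by
    rw [mul_smul]
    exact ha j _ (hb j v hv)
  add_mem' ha hb j v hv := by
    rw [add_smul]
    exact (E.1 j).add_mem (ha j v hv) (hb j v hv)
  algebraMap_mem' c j v hv := by
    rw [algebraMap_smul]
    exact (E.1 j).smul_mem c hv
  -- A nonzero stabilising scalar fixes the flag, hence so does its inverse.
  inv_mem' a ha := by
    rcases eq_or_ne a 0 with rfl | h0
    · intro j v _
      simp
    · have h := (stableUnder_unit_iff (Units.mk0 a h0) E).1 ha
      have h' := (stableUnder_unit_iff (Units.mk0 a h0)⁻¹ E).2 (inv_smul_eq_iff.2 h.symm)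
      simpa using h'

theorem card_stabilizer [Finite K] [FiniteDimensional k V] (E : PartialFlag k V n) :
    Nat.card (MulAction.stabilizer Kˣ E) = Nat.card (stableField (K := K) E) - 1 := by
  rw [← Nat.card_units]
  exact Nat.card_congr ⟨fun u => Units.mk0 ⟨(u.1 : K), (stableUnder_unit_iff u.1 E).2 u.2⟩
      (fun h => u.1.ne_zero (congrArg Subtype.val h)),
    fun u => ⟨Units.map (stableField (K := K) E).val.toMonoidHom u,
      (stableUnder_unit_iff _ E).1 u.1.2⟩,
    fun u => Subtype.ext (Units.ext rfl), fun u => Units.ext rfl⟩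

/-- The stabiliser of `E` is `Lˣ` for the field `L` of scalars preserving `E`. As `L ≠ K`, its
degree `d` is a proper divisor of `[K : k]`, and `(X ^ d - 1) Φ_ℓ` divides `X ^ ℓ - 1` for `ℓ = [K :
k]`. -/
theorem cyclotomic_dvd_card_orbit [Finite k] [Finite K] [FiniteDimensional k V]
    (E : PartialFlag k V n) (hE : ¬ ∀ a : K, E.StableUnder a) :
    (Polynomial.cyclotomic (Module.finrank k K) ℤ).eval (Nat.card k : ℤ) ∣
      (Nat.card (MulAction.orbit Kˣ E) : ℤ) := by
  have : FiniteDimensional k K := Module.Finite.of_finite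
  set L := stableField (K := K) E with hL
  set d := Module.finrank k L
  have hq : 1 < Nat.card k := Finite.one_lt_card
  have hdℓ : d ∣ Module.finrank k K := ⟨_, (Module.finrank_mul_finrank k L K).symm⟩
  have hne : d ≠ Module.finrank k K := by
    intro h
    have htop : L = ⊤ := IntermediateField.eq_of_le_of_finrank_eq le_top
      (h.trans IntermediateField.finrank_top'.symm)
    exact hE fun a => show a ∈ L by rw [htop]; trivial
  have hd : 0 < d := Module.finrank_pos
  have h1 := Polynomial.X_pow_sub_one_mul_cyclotomic_dvd_X_pow_sub_one_of_dvd ℤ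
    (Nat.mem_properDivisors.2 ⟨hdℓ, lt_of_le_of_ne (Nat.le_of_dvd Module.finrank_pos hdℓ) hne⟩)
  obtain ⟨R, hR⟩ := h1
  have h2 := congrArg (Polynomial.eval (Nat.card k : ℤ)) hR
  simp only [Polynomial.eval_mul, Polynomial.eval_sub, Polynomial.eval_pow, Polynomial.eval_X,
    Polynomial.eval_one] at h2
  have h3 := Subgroup.card_mul_index (MulAction.stabilizer Kˣ E)
  rw [MulAction.index_stabilizer, card_stabilizer, Nat.card_units,
    Module.natCard_eq_pow_finrank (K := k) (V := L),
    Module.natCard_eq_pow_finrank (K := k) (V := K)] at h3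
  have h4 := congrArg (Nat.cast (R := ℤ)) h3
  rw [Nat.cast_mul, Nat.cast_sub (Nat.one_le_pow _ _ (by omega)),
    Nat.cast_sub (Nat.one_le_pow _ _ (by omega))] at h4
  push_cast at h4
  rw [← h4, mul_assoc] at h2
  rw [Nat.card_coe_set_eq]
  refine ⟨_, mul_left_cancel₀ ?_ h2⟩
  exact sub_ne_zero.2 (one_lt_pow₀ (by exact_mod_cast hq) hd.ne').ne'

/-- The flags in given relative positions to two flags over the extension field that are not
stable under the extension field. -/
abbrev UnstableMiddle (A B : Matrix (Fin n) (Fin n) ℕ) (F F' : PartialFlag K V n) : Type :=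
  {E : Middle A B (F.restrictScalars k) (F'.restrictScalars k) // ¬ ∀ a : K, E.1.StableUnder a}

instance instMulActionUnstableMiddle (A B : Matrix (Fin n) (Fin n) ℕ) (F F' : PartialFlag K V n) :
    MulAction Kˣ (UnstableMiddle (k := k) A B F F') where
  smul u E := ⟨⟨u • E.1.1, by
      have h := relPos_smul u (F.restrictScalars k) E.1.1
      have h' := relPos_smul u E.1.1 (F'.restrictScalars k)
      rw [smul_restrictScalars] at h h'
      exact ⟨h.trans E.1.2.1, h'.trans E.1.2.2⟩⟩, fun h => E.2 fun a => by
        have := stableUnder_smul u⁻¹ a _ (h a)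
        rwa [inv_smul_smul] at this⟩
  one_smul E := Subtype.ext (Subtype.ext (one_smul Kˣ E.1.1))
  mul_smul u u' E := Subtype.ext (Subtype.ext (mul_smul u u' E.1.1))

theorem cyclotomic_dvd_card_unstableMiddle [Finite k] [Finite K] [Finite V]
    (A B : Matrix (Fin n) (Fin n) ℕ) (F F' : PartialFlag K V n) :
    (Polynomial.cyclotomic (Module.finrank k K) ℤ).eval (Nat.card k : ℤ) ∣
      (Nat.card (UnstableMiddle (k := k) A B F F') : ℤ) := by
  have : Fintype (MulAction.orbitRel.Quotient Kˣ (UnstableMiddle (k := k) A B F F')) :=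
    Fintype.ofFinite _
  rw [Nat.card_congr (MulAction.selfEquivSigmaOrbits Kˣ (UnstableMiddle (k := k) A B F F')),
    Nat.card_sigma]
  push_cast
  refine Finset.dvd_sum fun ω _ => ?_
  have h := cyclotomic_dvd_card_orbit (K := K) ω.out.1.1 ω.out.2
  -- Forgetting the position conditions is injective and equivariant, so it preserves orbit sizes.
  have h' : MulAction.orbit Kˣ ω.out.1.1 = (fun E => E.1.1) '' MulAction.orbit Kˣ ω.out :=
    (Set.range_comp (fun E : UnstableMiddle (k := k) A B F F' => E.1.1) (fun u : Kˣ => u • ω.out))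
  rw [h', Nat.card_image_of_injective (fun _ _ h => Subtype.ext (Subtype.ext h))] at h
  exact h

theorem card_middle_restrictScalars [Finite V] (A B : Matrix (Fin n) (Fin n) ℕ)
    (F F' : PartialFlag K V n) :
    Nat.card (Middle A B (F.restrictScalars k) (F'.restrictScalars k)) =
      Nat.card {E : Middle A B (F.restrictScalars k) (F'.restrictScalars k) //
        ∀ a : K, E.1.StableUnder a} + Nat.card (UnstableMiddle (k := k) A B F F') := by
  classical
  rw [← Nat.card_sum, Nat.card_congr (Equiv.sumCompl _)]

/-- The stable flags account for the subtracted term, being the `K`-flags in positions `A`, `B`; the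
unstable ones are the difference. -/
theorem cyclotomic_eval_dvd_sub [Finite k] [Finite K] [Finite V] (A B : Matrix (Fin n) (Fin n) ℕ)
    (F F' : PartialFlag K V n) :
    (Polynomial.cyclotomic (Module.finrank k K) ℤ).eval (Nat.card k : ℤ) ∣
      (structurePoly (scaleMatrix (Module.finrank k K) A) (scaleMatrix (Module.finrank k K) B)
        (scaleMatrix (Module.finrank k K) (relPos F F'))).eval (Nat.card k : ℤ) -
      (structurePoly A B (relPos F F')).eval (Nat.card K : ℤ) := by
  have : FiniteDimensional k K := Module.Finite.of_finite
  rw [← relPos_restrictScalars k, eval_structurePoly, eval_structurePoly,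
    card_middle_restrictScalars, card_stable_middle, Nat.cast_add, add_sub_cancel_left]
  exact cyclotomic_dvd_card_unstableMiddle _ _ F F'

theorem cyclotomic_eval_dvd [Finite k] [Finite K] [Finite V] {A B : Matrix (Fin n) (Fin n) ℕ}
    (h : ¬ ((∀ i j, Module.finrank k K ∣ A i j) ∧ ∀ i j, Module.finrank k K ∣ B i j))
    (F F' : PartialFlag K V n) :
    (Polynomial.cyclotomic (Module.finrank k K) ℤ).eval (Nat.card k : ℤ) ∣
      (structurePoly A B (scaleMatrix (Module.finrank k K) (relPos F F'))).eval
        (Nat.card k : ℤ) := by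
  have : FiniteDimensional k K := Module.Finite.of_finite
  have : IsEmpty {E : Middle A B (F.restrictScalars k) (F'.restrictScalars k) //
      ∀ a : K, E.1.StableUnder a} := ⟨fun E => h (dvd_of_stable_middle E.1 E.2)⟩
  rw [← relPos_restrictScalars k, eval_structurePoly, card_middle_restrictScalars,
    Nat.card_of_isEmpty (α := {E : Middle A B (F.restrictScalars k) (F'.restrictScalars k) //
      ∀ a : K, E.1.StableUnder a}), zero_add]
  exact cyclotomic_dvd_card_unstableMiddle _ _ F F'

end extension

/-! ### Congruences between structure polynomials -/

theorem exists_flags_relPos_eq {n : ℕ} (C : Matrix (Fin n) (Fin n) ℕ) (K : Type) [Field K] :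
    ∃ (m : ℕ) (F F' : PartialFlag K (Fin m → K) n), relPos F F' = C :=
  ⟨∑ i, ∑ j, C i j, exists_relPos_eq C (by simp)⟩

/-- Apply the count to the degree `ℓ` extension of `ZMod p` for each prime `p`; evaluation at `p ^
ℓ` is what `expand` encodes. -/
theorem cyclotomic_dvd_structurePoly_sub_expand {n ℓ : ℕ} (hℓ : 0 < ℓ)
    (A B C : Matrix (Fin n) (Fin n) ℕ) :
    Polynomial.cyclotomic ℓ ℤ ∣
      structurePoly (scaleMatrix ℓ A) (scaleMatrix ℓ B) (scaleMatrix ℓ C) -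
        Polynomial.expand ℤ ℓ (structurePoly A B C) := by
  refine dvd_of_forall_prime_eval_dvd (Polynomial.cyclotomic.monic ℓ ℤ) fun p hp => ?_
  have : Fact p.Prime := ⟨hp⟩
  obtain ⟨m, F, F', rfl⟩ := exists_flags_relPos_eq C (GaloisField p ℓ)
  have : Finite (GaloisField p ℓ) := Module.finite_of_finite (ZMod p)
  have h := cyclotomic_eval_dvd_sub (k := ZMod p) A B F F'
  rw [GaloisField.finrank p hℓ.ne', Nat.card_zmod, GaloisField.card p ℓ hℓ.ne', Nat.cast_pow] at h
  rwa [Polynomial.eval_sub, Polynomial.expand_eval]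

theorem cyclotomic_dvd_structurePoly {n ℓ : ℕ} (hℓ : 0 < ℓ) (A B C : Matrix (Fin n) (Fin n) ℕ)
    (h : ¬ ((∀ i j, ℓ ∣ A i j) ∧ ∀ i j, ℓ ∣ B i j)) :
    Polynomial.cyclotomic ℓ ℤ ∣ structurePoly A B (scaleMatrix ℓ C) := by
  refine dvd_of_forall_prime_eval_dvd (Polynomial.cyclotomic.monic ℓ ℤ) fun p hp => ?_
  have : Fact p.Prime := ⟨hp⟩
  obtain ⟨m, F, F', rfl⟩ := exists_flags_relPos_eq C (GaloisField p ℓ)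
  have : Finite (GaloisField p ℓ) := Module.finite_of_finite (ZMod p)
  have hf : Module.finrank (ZMod p) (GaloisField p ℓ) = ℓ := GaloisField.finrank p hℓ.ne'
  have h' := cyclotomic_eval_dvd (k := ZMod p) (by rwa [hf]) F F'
  rwa [hf, Nat.card_zmod] at h'

/-! ### Extension of scalars -/

section BaseChange

variable {R S B : Type} [CommRing R] [CommRing S] (φ : R →+* S) [Ring B] [Algebra R B]

/-- The ring homomorphism `b ↦ 1 ⊗ b`. -/
def BaseChange.ofHom : B →+* BaseChange φ B :=
  letI := φ.toAlgebra
  (Algebra.TensorProduct.includeRight : B →ₐ[R] S ⊗[R] B).toRingHom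

theorem BaseChange.ofHom_smul (r : R) (b : B) :
    BaseChange.ofHom φ (r • b) = φ r • BaseChange.ofHom φ b := by
  let := φ.toAlgebra
  change (1 : S) ⊗ₜ[R] (r • b) = φ r • ((1 : S) ⊗ₜ[R] b)
  rw [TensorProduct.tmul_smul]
  exact algebra_compatible_smul S r ((1 : S) ⊗ₜ[R] b)

/-- The basis of an extension of scalars induced by a basis. -/
def BaseChange.basis {ι : Type} (b : Module.Basis ι R B) : Module.Basis ι S (BaseChange φ B) :=
  letI := φ.toAlgebra
  (Algebra.TensorProduct.basis S b : Module.Basis ι S (S ⊗[R] B))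

theorem BaseChange.basis_apply {ι : Type} (b : Module.Basis ι R B) (i : ι) :
    BaseChange.basis φ b i = BaseChange.of φ (b i) :=
  letI := φ.toAlgebra
  Algebra.TensorProduct.basis_apply b i

end BaseChange

/-! ### The basis of the generic `q`-Schur algebra -/

theorem entry_le {n m : ℕ} (A : Θ n m) (i j : Fin n) : A.1 i j ≤ m := by
  refine le_of_le_of_eq ?_ A.2
  exact (Finset.single_le_sum (f := fun j => A.1 i j) (fun _ _ => Nat.zero_le _)
    (Finset.mem_univ j)).trans (Finset.single_le_sum (f := fun i => ∑ j, A.1 i j)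
      (fun _ _ => Nat.zero_le _) (Finset.mem_univ i))

instance instFiniteΘ (n m : ℕ) : Finite (Θ n m) :=
  Finite.of_injective
    (fun A : Θ n m => fun i j => (⟨A.1 i j, Nat.lt_succ_of_le (entry_le A i j)⟩ : Fin (m + 1)))
    fun _ _ h => Subtype.ext <| funext fun i => funext fun j =>
      congrArg Fin.val (congrFun (congrFun h i) j)

instance instFintypeΘ (n m : ℕ) : Fintype (Θ n m) := Fintype.ofFinite _

/-- The label of the orbit of a pair of flags. -/
def orbitLabel {k : Type} [Field k] {n m : ℕ} (F F' : PartialFlag k (Fin m → k) n) : Θ n m :=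
  ⟨relPos F F', by rw [sum_relPos, Module.finrank_fin_fun]⟩

theorem orbitLabel_eq_iff {k : Type} [Field k] {n m : ℕ} {F F' : PartialFlag k (Fin m → k) n}
    {A : Θ n m} : orbitLabel F F' = A ↔ relPos F F' = A.1 :=
  Subtype.ext_iff

section SchurFamily

variable {n m : ℕ}

/-- The value of a family of functions at a pair of flags. -/
def SchurFamily.entry (x : FieldIndex) (F F' : PartialFlag (FF x) (Fin m → FF x) n) :
    SchurFamily n m →+ ℤ where
  toFun f := (f x).1 F F'
  map_zero' := rfl
  map_add' _ _ := rfl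

theorem SchurFamily.ext_entry {f g : SchurFamily n m}
    (h : ∀ x F F', SchurFamily.entry x F F' f = SchurFamily.entry x F F' g) : f = g :=
  funext fun x => Subtype.ext <| funext fun F => funext fun F' => h x F F'

theorem SchurFamily.entry_smul (x : FieldIndex) (F F' : PartialFlag (FF x) (Fin m → FF x) n)
    (p : ℤ[X]) (f : SchurFamily n m) :
    SchurFamily.entry x F F' (p • f) =
      p.eval (Nat.card (FF x) : ℤ) * SchurFamily.entry x F F' f := by
  have h : (p • f) x = (p.eval (Nat.card (FF x) : ℤ)) • f x := by
    rw [Algebra.smul_def, Algebra.smul_def]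
    rfl
  change ((p • f) x).1 F F' = _
  rw [h]
  rfl

theorem SchurFamily.entry_mul (x : FieldIndex) (F F' : PartialFlag (FF x) (Fin m → FF x) n)
    (f g : SchurFamily n m) :
    SchurFamily.entry x F F' (f * g) =
      ∑ E, SchurFamily.entry x F E f * SchurFamily.entry x E F' g := rfl

open Classical in
theorem SchurFamily.entry_one (x : FieldIndex) (F F' : PartialFlag (FF x) (Fin m → FF x) n) :
    SchurFamily.entry x F F' (1 : SchurFamily n m) = if F = F' then 1 else 0 := by
  change (1 : Matrix _ _ ℤ) F F' = _
  rw [Matrix.one_apply]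

open Classical in
theorem SchurFamily.entry_indicatorFamily (x : FieldIndex)
    (F F' : PartialFlag (FF x) (Fin m → FF x) n) (A : Θ n m) :
    SchurFamily.entry x F F' (indicatorFamily A) = if orbitLabel F F' = A then 1 else 0 := by
  change (if relPos F F' = A.1 then (1 : ℤ) else 0) = _
  simp only [orbitLabel_eq_iff]

theorem SchurFamily.entry_sum_smul (x : FieldIndex) (F F' : PartialFlag (FF x) (Fin m → FF x) n)
    (f : Θ n m → ℤ[X]) :
    SchurFamily.entry x F F' (∑ A, f A • indicatorFamily A) =
      (f (orbitLabel F F')).eval (Nat.card (FF x) : ℤ) := by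
  classical
  simp only [map_sum, SchurFamily.entry_smul, SchurFamily.entry_indicatorFamily]
  simp

theorem indicatorFamily_mul (A B : Θ n m) :
    indicatorFamily A * indicatorFamily B =
      ∑ C : Θ n m, structurePoly A.1 B.1 C.1 • indicatorFamily C := by
  classical
  refine SchurFamily.ext_entry fun x F F' => ?_
  rw [SchurFamily.entry_sum_smul, SchurFamily.entry_mul]
  simp only [SchurFamily.entry_indicatorFamily, ite_mul, one_mul, zero_mul, ← ite_and]
  change _ = (structurePoly A.1 B.1 (relPos F F')).eval _
  rw [eval_structurePoly, Nat.card_eq_fintype_card, Fintype.card_subtype, Finset.sum_boole]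
  simp only [orbitLabel_eq_iff]

open Classical in
theorem one_eq_sum_indicatorFamily :
    (1 : SchurFamily n m) = ∑ A : Θ n m, (if A.1.IsDiag then 1 else 0 : ℤ[X]) •
      indicatorFamily A := by
  refine SchurFamily.ext_entry fun x F F' => ?_
  rw [SchurFamily.entry_sum_smul, SchurFamily.entry_one]
  simp only [orbitLabel, relPos_isDiag_iff]
  split_ifs <;> simp

theorem card_FF (x : FieldIndex) : Nat.card (FF x) = (x.1 : ℕ) ^ (x.2 : ℕ) :=
  GaloisField.card _ _ x.2.ne_zero

/-- Evaluating a relation at flags in position `A` over the field with `p` elements shows that the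
coefficient at `A` vanishes at `p`. -/
theorem linearIndependent_indicatorFamily :
    LinearIndependent ℤ[X] (indicatorFamily : Θ n m → SchurFamily n m) := by
  rw [Fintype.linearIndependent_iff]
  intro f hf A
  refine eq_of_forall_prime_eval_eq fun p hp => ?_
  obtain ⟨x, h3⟩ : ∃ x : FieldIndex, Nat.card (FF x) = p :=
    ⟨(⟨p, hp⟩, 1), (card_FF _).trans (pow_one p)⟩
  obtain ⟨F, F', h⟩ := exists_relPos_eq (k := FF x) (V := Fin m → FF x) A.1
    (by rw [Module.finrank_fin_fun, A.2])
  have h1 := SchurFamily.entry_sum_smul x F F' f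
  have h2 : orbitLabel F F' = A := Subtype.ext h
  rw [hf, map_zero, h2, h3] at h1
  rw [← h1, Polynomial.eval_zero]

/-- The span is already a subalgebra: it contains the unit and, by `indicatorFamily_mul`, all
products. -/
theorem toSubmodule_qSchur :
    Subalgebra.toSubmodule (QSchur n m) =
      Submodule.span ℤ[X] (Set.range (indicatorFamily : Θ n m → SchurFamily n m)) := by
  classical
  apply le_antisymm
  · intro f hf
    refine Algebra.adjoin_induction (p := fun f _ => f ∈ Submodule.span ℤ[X]
      (Set.range (indicatorFamily : Θ n m → SchurFamily n m))) ?_ ?_ ?_ ?_ hf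
    · exact fun f hf => Submodule.subset_span hf
    · intro p
      rw [Algebra.algebraMap_eq_smul_one, one_eq_sum_indicatorFamily]
      exact Submodule.smul_mem _ _ (Submodule.sum_mem _ fun A _ =>
        Submodule.smul_mem _ _ (Submodule.subset_span ⟨A, rfl⟩))
    · exact fun f g _ _ hf hg => Submodule.add_mem _ hf hg
    · intro f g _ _ hf hg
      have h := Submodule.mul_mem_mul hf hg
      rw [Submodule.span_mul_span] at h
      refine Submodule.span_le.2 ?_ h
      rintro _ ⟨_, ⟨A, rfl⟩, _, ⟨B, rfl⟩, rfl⟩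
      change indicatorFamily A * indicatorFamily B ∈ _
      rw [indicatorFamily_mul]
      exact Submodule.sum_mem _ fun C _ =>
        Submodule.smul_mem _ _ (Submodule.subset_span ⟨C, rfl⟩)
  · exact Submodule.span_le.2 Algebra.subset_adjoin

/-- The basis `1_A` of the generic `q`-Schur algebra. -/
def QSchur.basis (n m : ℕ) : Module.Basis (Θ n m) ℤ[X] (QSchur n m) :=
  (Module.Basis.span (linearIndependent_indicatorFamily (n := n) (m := m))).map
    (LinearEquiv.ofEq _ _ toSubmodule_qSchur.symm)

theorem QSchur.basis_apply (A : Θ n m) : QSchur.basis n m A = QSchur.one A := by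
  apply Subtype.ext
  rw [QSchur.basis, Module.Basis.map_apply]
  exact congrArg (Subtype.val : Submodule.span ℤ[X] (Set.range indicatorFamily) → SchurFamily n m)
    (Module.Basis.span_apply (linearIndependent_indicatorFamily (n := n) (m := m)) A)

theorem QSchur.one_mul_one (A B : Θ n m) :
    QSchur.one A * QSchur.one B = ∑ C : Θ n m, structurePoly A.1 B.1 C.1 • QSchur.one C := by
  apply Subtype.ext
  rw [AddSubmonoidClass.coe_finsetSum]
  exact indicatorFamily_mul A B

end SchurFamily

/-! ### Specialisations -/

section SchurSpec

variable {R : Type} [CommRing R] (φ : ℤ[T;T⁻¹] →+* R) {n m : ℕ}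

/-- The basis `1_A` of a specialisation of the `q`-Schur algebra. -/
def SchurSpec.basis (n m : ℕ) : Module.Basis (Θ n m) R (SchurSpec φ n m) :=
  BaseChange.basis φ (BaseChange.basis qToV (QSchur.basis n m))

theorem SchurSpec.basis_apply (A : Θ n m) : SchurSpec.basis φ n m A = SchurSpec.one φ A := by
  rw [SchurSpec.basis, BaseChange.basis_apply, BaseChange.basis_apply, QSchur.basis_apply]
  rfl

theorem SchurSpec.one_mul_one (A B : Θ n m) :
    SchurSpec.one φ A * SchurSpec.one φ B =
      ∑ C : Θ n m, φ (qToV (structurePoly A.1 B.1 C.1)) • SchurSpec.one φ C := by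
  have h : ∀ A : Θ n m, SchurSpec.one φ A =
    BaseChange.ofHom φ (BaseChange.ofHom qToV (QSchur.one A)) := fun _ => rfl
  simp only [h, ← map_mul, QSchur.one_mul_one, map_sum, BaseChange.ofHom_smul]

/-- Both sides send `q` to `φ(v) ^ (2ℓ)`. Thus the structure constants of the target are those at `q
^ ℓ`. -/
theorem powSpec_qToV (ℓ : ℕ) (p : ℤ[X]) :
    powSpec φ ℓ (qToV p) = φ (qToV (Polynomial.expand ℤ ℓ p)) := by
  have h : ((powSpec φ ℓ).comp qToV) =
      (φ.comp qToV).comp (Polynomial.expand ℤ ℓ : ℤ[X] →+* ℤ[X]) := by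
    refine Polynomial.ringHom_ext' (RingHom.ext_int _ _) ?_
    have h2 : (LaurentPolynomial.T 2 : ℤ[T;T⁻¹]) = (LaurentPolynomial.T 1) ^ 2 := by
      rw [LaurentPolynomial.T_pow]; rfl
    simp only [RingHom.comp_apply, qToV, Polynomial.coe_eval₂RingHom, Polynomial.eval₂_X,
      RingHom.coe_coe, Polynomial.expand_X, h2, map_pow]
    rw [← pow_mul, mul_comm, pow_mul]
    congr 1
    simp [powSpec, vUnit]
  exact RingHom.congr_fun h p

end SchurSpec

/-- `Φ_ℓ(v ^ 2)` is `Φ_{2ℓ}(v)` for even `ℓ` and `Φ_{2ℓ}(v) Φ_ℓ(v)` for odd `ℓ`. -/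
theorem cycloMap_qToV_cyclotomic {ℓ : ℕ} : cycloMap ℓ (qToV (Polynomial.cyclotomic ℓ ℤ)) = 0 := by
  have h : qToV = (Polynomial.toLaurent (R := ℤ)).comp
      (Polynomial.expand ℤ 2 : ℤ[X] →+* ℤ[X]) := by
    refine Polynomial.ringHom_ext' (RingHom.ext_int _ _) ?_
    simp [qToV]
  have h2 : Polynomial.cyclotomic (2 * ℓ) ℤ ∣ Polynomial.expand ℤ 2 (Polynomial.cyclotomic ℓ ℤ) := by
    rw [mul_comm]
    by_cases h2 : 2 ∣ ℓ
    · rw [Polynomial.cyclotomic_expand_eq_cyclotomic Nat.prime_two h2]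
    · rw [Polynomial.cyclotomic_expand_eq_cyclotomic_mul Nat.prime_two h2]
      exact dvd_mul_right _ _
  rw [cycloMap, Ideal.Quotient.eq_zero_iff_dvd, h]
  exact map_dvd Polynomial.toLaurent h2

theorem cycloMap_qToV_eq_zero {ℓ : ℕ} {p : ℤ[X]} (h : Polynomial.cyclotomic ℓ ℤ ∣ p) :
    cycloMap ℓ (qToV p) = 0 := by
  obtain ⟨s, rfl⟩ := h
  rw [map_mul, map_mul, cycloMap_qToV_cyclotomic, zero_mul]

/-! ### The quantum Frobenius homomorphism -/

theorem Θ.scale_injective {n r ℓ : ℕ} (hℓ : 0 < ℓ) :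
    Function.Injective (Θ.scale ℓ : Θ n r → Θ n (ℓ * r)) := fun _ _ h =>
  Subtype.ext <| funext fun i => funext fun j =>
    Nat.eq_of_mul_eq_mul_left hℓ (congrFun (congrFun (congrArg Subtype.val h) i) j)

theorem Θ.exists_scale_eq_iff {n r ℓ : ℕ} (hℓ : 0 < ℓ) (A : Θ n (ℓ * r)) :
    (∃ A' : Θ n r, A'.scale ℓ = A) ↔ ∀ i j, ℓ ∣ A.1 i j := by
  constructor
  · rintro ⟨A', rfl⟩ i j
    exact dvd_mul_right ℓ _
  · intro h
    have h1 : ∀ i j, ℓ * (A.1 i j / ℓ) = A.1 i j := fun i j => Nat.mul_div_cancel' (h i j)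
    refine ⟨⟨fun i j => A.1 i j / ℓ, Nat.eq_of_mul_eq_mul_left hℓ ?_⟩,
      Subtype.ext <| funext fun i => funext fun j => h1 i j⟩
    simp only [Finset.mul_sum, h1]
    exact A.2

section Frobenius

variable {n ℓ : ℕ} (r : ℕ)

/-- The linear map underlying the quantum Frobenius homomorphism. -/
def frobeniusLinear (n ℓ r : ℕ) : SchurSpec (cycloMap ℓ) n (ℓ * r) →ₗ[CycloRing ℓ]
    SchurSpec (powSpec (cycloMap ℓ) ℓ) n r :=
  (SchurSpec.basis (cycloMap ℓ) n (ℓ * r)).constr ℕ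
    -- The default value `0` of the extension is the prescribed value off the multiples of `ℓ`.
    (Function.extend (Θ.scale ℓ) (SchurSpec.one (powSpec (cycloMap ℓ) ℓ)) 0)

theorem frobeniusLinear_one (A : Θ n (ℓ * r)) :
    frobeniusLinear n ℓ r (SchurSpec.one (cycloMap ℓ) A) =
      Function.extend (Θ.scale ℓ) (SchurSpec.one (powSpec (cycloMap ℓ) ℓ)) 0 A := by
  rw [← SchurSpec.basis_apply, frobeniusLinear, Module.Basis.constr_basis]

theorem frobeniusLinear_scale (hℓ : 0 < ℓ) (A : Θ n r) :
    frobeniusLinear n ℓ r (SchurSpec.one (cycloMap ℓ) (A.scale ℓ)) =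
      SchurSpec.one (powSpec (cycloMap ℓ) ℓ) A := by
  rw [frobeniusLinear_one, (Θ.scale_injective hℓ).extend_apply]

theorem frobeniusLinear_eq_zero (hℓ : 0 < ℓ) (A : Θ n (ℓ * r)) (h : ¬ ∀ i j, ℓ ∣ A.1 i j) :
    frobeniusLinear n ℓ r (SchurSpec.one (cycloMap ℓ) A) = 0 := by
  rw [frobeniusLinear_one, Function.extend_apply' _ _ _ fun h' =>
    h ((Θ.exists_scale_eq_iff hℓ A).1 h')]
  rfl

theorem frobeniusLinear_surjective (hℓ : 0 < ℓ) :
    Function.Surjective (frobeniusLinear n ℓ r) := by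
  rw [← LinearMap.range_eq_top, eq_top_iff,
    ← (SchurSpec.basis (powSpec (cycloMap ℓ) ℓ) n r).span_eq, Submodule.span_le]
  rintro _ ⟨A, rfl⟩
  exact ⟨_, by rw [SchurSpec.basis_apply, frobeniusLinear_scale r hℓ]⟩

theorem frobeniusLinear_one_mul_one (hℓ : 0 < ℓ) (A B : Θ n (ℓ * r)) :
    frobeniusLinear n ℓ r (SchurSpec.one (cycloMap ℓ) A * SchurSpec.one (cycloMap ℓ) B) =
      frobeniusLinear n ℓ r (SchurSpec.one (cycloMap ℓ) A) *
        frobeniusLinear n ℓ r (SchurSpec.one (cycloMap ℓ) B) := by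
  have h1 : frobeniusLinear n ℓ r
      (SchurSpec.one (cycloMap ℓ) A * SchurSpec.one (cycloMap ℓ) B) =
      ∑ C : Θ n r, cycloMap ℓ (qToV (structurePoly A.1 B.1 (scaleMatrix ℓ C.1))) •
        SchurSpec.one (powSpec (cycloMap ℓ) ℓ) C := by
    rw [SchurSpec.one_mul_one, map_sum]
    symm
    -- Only the terms with label `ℓ C` survive, so only these structure constants matter.
    refine Fintype.sum_of_injective (Θ.scale ℓ) (Θ.scale_injective hℓ) _ _ (fun C hC => ?_)
      fun C => ?_
    · rw [map_smul, frobeniusLinear_eq_zero r hℓ C fun h =>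
        hC ((Θ.exists_scale_eq_iff hℓ C).2 h), smul_zero]
    · rw [map_smul, frobeniusLinear_scale r hℓ]
      rfl
  rw [h1]
  by_cases hA : ∀ i j, ℓ ∣ A.1 i j
  · by_cases hB : ∀ i j, ℓ ∣ B.1 i j
    · obtain ⟨A, rfl⟩ := (Θ.exists_scale_eq_iff hℓ A).2 hA
      obtain ⟨B, rfl⟩ := (Θ.exists_scale_eq_iff hℓ B).2 hB
      rw [frobeniusLinear_scale r hℓ, frobeniusLinear_scale r hℓ, SchurSpec.one_mul_one]
      refine Finset.sum_congr rfl fun C _ => ?_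
      congr 1
      rw [powSpec_qToV, ← sub_eq_zero, ← map_sub, ← map_sub]
      exact cycloMap_qToV_eq_zero (cyclotomic_dvd_structurePoly_sub_expand hℓ A.1 B.1 C.1)
    · rw [frobeniusLinear_eq_zero r hℓ B hB, mul_zero]
      exact Finset.sum_eq_zero fun C _ => by
        rw [cycloMap_qToV_eq_zero (cyclotomic_dvd_structurePoly hℓ A.1 B.1 C.1 fun h => hB h.2)]
        rw [Algebra.smul_def, map_zero, zero_mul]
  · rw [frobeniusLinear_eq_zero r hℓ A hA, zero_mul]
    exact Finset.sum_eq_zero fun C _ => by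
      rw [cycloMap_qToV_eq_zero (cyclotomic_dvd_structurePoly hℓ A.1 B.1 C.1 fun h => hA h.1)]
      rw [Algebra.smul_def, map_zero, zero_mul]

theorem frobeniusLinear_mul (hℓ : 0 < ℓ) (x y : SchurSpec (cycloMap ℓ) n (ℓ * r)) :
    frobeniusLinear n ℓ r (x * y) = frobeniusLinear n ℓ r x * frobeniusLinear n ℓ r y := by
  revert x y
  rw [LinearMap.map_mul_iff]
  refine (SchurSpec.basis (cycloMap ℓ) n (ℓ * r)).ext fun A =>
    (SchurSpec.basis (cycloMap ℓ) n (ℓ * r)).ext fun B => ?_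
  rw [SchurSpec.basis_apply, SchurSpec.basis_apply]
  exact frobeniusLinear_one_mul_one r hℓ A B

/-- The quantum Frobenius homomorphism between `q`-Schur algebras. -/
def frobenius (hℓ : 0 < ℓ) : SchurSpec (cycloMap ℓ) n (ℓ * r) →ₐ[CycloRing ℓ]
    SchurSpec (powSpec (cycloMap ℓ) ℓ) n r :=
  AlgHom.ofLinearMap (frobeniusLinear n ℓ r)
    (by
      -- The image of `1` is a left identity on the range, which is everything; test it on a
      -- preimage `x` of `1`.
      obtain ⟨x, hx⟩ := frobeniusLinear_surjective (n := n) r hℓ 1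
      rw [← mul_one (frobeniusLinear n ℓ r 1), ← hx, ← frobeniusLinear_mul r hℓ, one_mul])
    (frobeniusLinear_mul r hℓ)

end Frobenius

end QSchurFrobenius
end

theorem corollary3p4 (n r ℓ : ℕ) (hn : 0 < n) (hℓ : 0 < ℓ) :
    (∀ m : ℕ, ∃ b : Module.Basis (QSchurFrobenius.Θ n m) ℤ[X] (QSchurFrobenius.QSchur n m),
      ∀ A, b A = QSchurFrobenius.QSchur.one A) ∧
    ∃ Q : QSchurFrobenius.SchurSpec (QSchurFrobenius.cycloMap ℓ) n (ℓ * r)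
        →ₐ[QSchurFrobenius.CycloRing ℓ]
        QSchurFrobenius.SchurSpec
          (QSchurFrobenius.powSpec (QSchurFrobenius.cycloMap ℓ) ℓ) n r,
      Function.Surjective Q ∧
      (∀ A' : QSchurFrobenius.Θ n r,
        Q (QSchurFrobenius.SchurSpec.one (QSchurFrobenius.cycloMap ℓ) (A'.scale ℓ)) =
          QSchurFrobenius.SchurSpec.one
            (QSchurFrobenius.powSpec (QSchurFrobenius.cycloMap ℓ) ℓ) A') ∧
      (∀ A : QSchurFrobenius.Θ n (ℓ * r), (¬ ∀ i j, ℓ ∣ A.1 i j) →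
        Q (QSchurFrobenius.SchurSpec.one (QSchurFrobenius.cycloMap ℓ) A) = 0) :=
  ⟨fun m => ⟨QSchurFrobenius.QSchur.basis n m, QSchurFrobenius.QSchur.basis_apply⟩,
    QSchurFrobenius.frobenius r hℓ, QSchurFrobenius.frobeniusLinear_surjective r hℓ,
    QSchurFrobenius.frobeniusLinear_scale r hℓ, QSchurFrobenius.frobeniusLinear_eq_zero r hℓ⟩
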